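/- Let $g$ be a generator of a finite cyclic group of order $r \ge 2$ (written multiplicatively), let $m, \ell$ be positive integers with $2^m > r$ and $2^{m+\ell} > r^2$, let $c \ge 1$ be real, and let $B$ be an integer with $1 \le B < B_{\max} = \frac12\left(\frac{2^{m+\ell}}{r} - 1\right)$. Write $n = m+\ell$, and $\log$ for the base-two logarithm. **Quantum part.** The state $$\frac{1}{2^{n}} \sum_{a=0}^{2^{n}-1}\ \sum_{j=0}^{2^{n}-1} \exp\left[\frac{2\pi i}{2^{n}}\, a j\right] |j, g^a\rangle$$ is induced and its first register is measured, which yields a frequency $j \in \{0, \ldots, 2^n-1\}$. **Classical post-processing.** Each of the integers $j' = j+t$, $t = -B, \ldots, B$, is mapped to a candidate, all by one of the following two solvers: - *continued fractions-based:* the candidate is the denominator $q$ of the last convergent $p/q$ (in lowest terms) with $q < 2^{n/2}$ in the continued fraction expansion of $j'/2^n$; - *lattice-based:* the candidate is $2|s_2|$, where $(s_1, s_2)$ is a shortest non-zero vector (an arbitrary one, if there are several) of the lattice spanned by $(j', \frac12)$ and $(2^n, 0)$. Let $q_1 < \cdots < q_k$ be the primes $\le cm$, let $e_i = \lfloor \log_{q_i}(cm)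 \rfloor$, and let $E = \prod_i q_i^{e_i}$. Optionally, only the candidates $\rho \in [1, 2^m)$ with $(g^{E})^{\rho} = 1$ are kept. Each remaining candidate $\rho$ is passed to one of the following two recovery algorithms (the same one for all candidates); both fail if $\rho \notin [1, 2^m)$: - *stack-based:* Let $x \leftarrow g^{\rho}$. If $x = 1$, return $\rho$. For $i = 1, 2, \ldots, k$: push $(x, q_i, e_i)$ onto an initially empty stack and let $x \leftarrow x^{q_i^{e_i}}$, stopping this loop as soon as $x = 1$. If $x \ne 1$ after the loop, fail. Let $d \leftarrow 1$. While the stack is non-empty: pop $(x, q, e)$, let $x \leftarrow x^d$, and at most $e$ times, as long as $x \neq 1$, let $x \leftarrow x^q$ and $d \leftarrow dq$. Return $d\rho$. - *tree-based:* For an element $x$ and a list $F$ of primes, define recursively a list $R(x, F)$ of pairs: $R(x, (q)) = ((q, x))$, and for longer $F$, split $F$ into its first $\lfloor |F|/2 \rfloor$ elements $F_L$ and the remaining elements $F_R$, and let $R(x, F)$ be the concatenation of $R(x^{d_L}, F_L)$ and $R(x^{d_R}, F_R)$, where $d_L = \prod_{q \in F_R} q^{\lfloor \log_q (cm) \rfloor}$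 and $d_R = \prod_{q \in F_L} q^{\lfloor \log_q (cm) \rfloor}$. Let $d \leftarrow 1$. For each pair $(q_i, x_i)$ in $R(g^{\rho}, (q_1, \ldots, q_k))$: while $x_i \ne 1$, let $x_i \leftarrow x_i^{q_i}$ and $d \leftarrow d q_i$, but fail if this would have to be done more than $e_i$ times. Return $d\rho$. The result of the post-processing is the minimum of the values returned for the candidates (a failure if none is returned). **Claim.** For either solver, either recovery algorithm, and with or without the optional filtering, a single run of the quantum part followed by the post-processing returns $r$ with probability at least $$\left(1 - \frac{1}{\pi^2}\left(\frac{2}{B} + \frac{1}{B^2} + \frac{1}{3B^3}\right) - \frac{\pi^2 r (2B+1)}{2^{m+\ell}}\right)\left(1 - \frac{1}{c \log cm}\right).$$ -/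

import Mathlib

open scoped BigOperators

namespace OrderFinding

noncomputable section

/-! ### The quantum part -/

/-- The state `2⁻ⁿ ∑_{a, j = 0}^{2ⁿ - 1} exp (2πi a j / 2ⁿ) |j, gᵃ⟩` induced by the order-finding
algorithm with an `n`-bit exponent register. -/
def state {G : Type*} [Group G] [Fintype G] [DecidableEq G] (g : G) (n : ℕ) :
    EuclideanSpace ℂ (Fin (2 ^ n) × G) :=
  ∑ a : Fin (2 ^ n), ∑ j : Fin (2 ^ n),
    ((1 / (2 : ℂ) ^ n) *
        Complex.exp (2 * Real.pi * Complex.I / (2 : ℂ) ^ n * ((a : ℕ) : ℂ) * ((j : ℕ) : ℂ))) •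
      EuclideanSpace.single (j, g ^ (a : ℕ)) (1 : ℂ)

/-- The probability of observing the frequency `j` when the first register of the state is
measured (Born rule). -/
def freqProb {G : Type*} [Group G] [Fintype G] [DecidableEq G] (g : G) (n : ℕ)
    (j : Fin (2 ^ n)) : ℝ :=
  ∑ h : G, ‖state g n (j, h)‖ ^ 2

/-! ### Solving a frequency for a candidate for `r / gcd (r, z)` -/

/-- The indices of the convergents of the (finite) continued fraction of `x`: the convergent with
index `k + 1` is present iff the `k`-th partial quotient after the integer part is. -/
def convergentIndices (x : ℚ) : Set ℕ :=
  {k | k = 0 ∨ ¬ (GenContFract.of x).TerminatedAt (k - 1)}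

/-- The denominator `q` of the `k`-th convergent `p / q` (in lowest terms) of `x`. -/
def convergentDen (x : ℚ) (k : ℕ) : ℕ := ((GenContFract.of x).convs k).den

/-- The continued fractions-based solver: the denominator of the last convergent `p / q` with
`q < 2 ^ (n / 2)`, i.e. `q ^ 2 < 2 ^ n`, in the continued fraction expansion of `j / 2 ^ n`. -/
def cfSolver (n : ℕ) (j : ℤ) : ℕ :=
  convergentDen ((j : ℚ) / 2 ^ n)
    (sSup {k ∈ convergentIndices ((j : ℚ) / 2 ^ n) |
      convergentDen ((j : ℚ) / 2 ^ n) k ^ 2 < 2 ^ n})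

/-- The lattice spanned by `(j, 1/2)` and `(2 ^ n, 0)`. -/
def freqLattice (n : ℕ) (j : ℤ) : Submodule ℤ (EuclideanSpace ℝ (Fin 2)) :=
  Submodule.span ℤ {!₂[(j : ℝ), 1 / 2], !₂[(2 : ℝ) ^ n, 0]}

/-- `s` is a shortest non-zero vector of the lattice `L`. -/
def IsShortestNonzero (L : Submodule ℤ (EuclideanSpace ℝ (Fin 2)))
    (s : EuclideanSpace ℝ (Fin 2)) : Prop :=
  s ∈ L ∧ s ≠ 0 ∧ ∀ w ∈ L, w ≠ 0 → ‖s‖ ≤ ‖w‖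

/-- `solve` is a lattice-based solver: for each frequency `j` it finds some shortest non-zero vector
`(s₁, s₂)` of the lattice spanned by `(j, 1/2)` and `(2 ^ n, 0)` and returns `2 |s₂|`.  The shortest
vector is in general not unique; no assumption is made on which one is found. -/
def IsLatticeSolver (n : ℕ) (solve : ℤ → ℕ) : Prop :=
  ∀ j : ℤ, ∃ s : EuclideanSpace ℝ (Fin 2),
    IsShortestNonzero (freqLattice n j) s ∧ (solve j : ℝ) = 2 * |s 1|

/-- Lattice-based solvers exist. -/
theorem exists_isLatticeSolver (n : ℕ) : ∃ solve : ℤ → ℕ, IsLatticeSolver n solve := by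
  suffices h : ∀ j : ℤ, ∃ q : ℕ, ∃ s : EuclideanSpace ℝ (Fin 2),
      IsShortestNonzero (freqLattice n j) s ∧ (q : ℝ) = 2 * |s 1| by
    choose f hf using h
    exact ⟨f, hf⟩
  intro j
  let v : ℤ × ℤ → EuclideanSpace ℝ (Fin 2) := fun p =>
    p.1 • !₂[(j : ℝ), 1 / 2] + p.2 • !₂[(2 : ℝ) ^ n, 0]
  let N : ℤ × ℤ → ℕ := fun p => ((2 * (p.1 * j + p.2 * 2 ^ n)) ^ 2 + p.1 ^ 2).toNat
  have hv1 : ∀ p, v p 1 = (p.1 : ℝ) / 2 := by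
    intro p; simp [v]; ring
  have hN : ∀ p, (N p : ℝ) = 4 * ‖v p‖ ^ 2 := by
    intro p
    have h0 : ((N p : ℤ) : ℝ) = ((2 * (p.1 * j + p.2 * 2 ^ n)) ^ 2 + p.1 ^ 2 : ℤ) := by
      congr 1
      exact Int.toNat_of_nonneg (by positivity)
    rw [EuclideanSpace.norm_sq_eq, Fin.sum_univ_two, hv1]
    have h1 : v p 0 = p.1 * j + p.2 * 2 ^ n := by simp [v]
    rw [h1]
    have h2 : ((N p : ℤ) : ℝ) = (N p : ℝ) := by norm_cast
    rw [← h2, h0]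
    simp only [Real.norm_eq_abs, sq_abs]
    push_cast
    ring
  have hmem : ∀ w, w ∈ freqLattice n j ↔ ∃ p, v p = w := by
    intro w
    simp [freqLattice, Submodule.mem_span_pair, v]
  have hne : {p | v p ≠ 0}.Nonempty := by
    refine ⟨(1, 0), fun h => ?_⟩
    have := hv1 (1, 0)
    rw [h] at this
    norm_num at this
  obtain ⟨p, hp, hmin⟩ : ∃ p ∈ {p | v p ≠ 0}, ∀ p' ∈ {p | v p ≠ 0}, N p ≤ N p' :=
    ⟨Function.argminOn N _ hne, Function.argminOn_mem N _ hne,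
      fun p' hp' => Function.argminOn_le N _ hp'⟩
  refine ⟨p.1.natAbs, v p, ⟨(hmem _).2 ⟨p, rfl⟩, hp, ?_⟩, ?_⟩
  · intro w hw hw0
    obtain ⟨p', rfl⟩ := (hmem _).1 hw
    have h1 : (N p : ℝ) ≤ N p' := by exact_mod_cast hmin p' hw0
    rw [hN, hN] at h1
    exact le_of_sq_le_sq (by linarith) (norm_nonneg _)
  · rw [hv1, abs_div, Nat.cast_natAbs]
    push_cast
    rw [abs_of_pos (show (0 : ℝ) < 2 by norm_num)]
    ring

/-! ### Recovering `r` from a candidate for `r / gcd (r, z)`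

Below, the real number `x` plays the role of `c * m`. -/

/-- The primes `≤ x` in increasing order. -/
def primesUpTo (x : ℝ) : List ℕ := (List.range (⌊x⌋₊ + 1)).filter Nat.Prime

/-- `⌊log_q x⌋` -/
def maxExp (x : ℝ) (q : ℕ) : ℕ := ⌊Real.logb q x⌋₊

section Recover

variable {G : Type*} [Group G] [DecidableEq G]

/-- First loop of the stack-based algorithm: for each prime `q`, push `(y, q, e)` with
`e = ⌊log_q x⌋` onto the stack and let `y ← y ^ (q ^ e)`, until `y = 1`. Returns the final `y` and
the stack. -/
def pushLoop (x : ℝ) : List ℕ → G → List (G × ℕ × ℕ) → G × List (G × ℕ × ℕ)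
  | [], y, S => (y, S)
  | q :: qs, y, S =>
    let e := maxExp x q
    let y' := y ^ (q ^ e)
    if y' = 1 then (y', (y, q, e) :: S) else pushLoop x qs y' ((y, q, e) :: S)

/-- At most `e` times, until `y = 1`: let `y ← y ^ q` and `d ← d * q`. Returns the final `d`. -/
def climb (q : ℕ) : ℕ → G → ℕ → ℕ
  | 0, _, d => d
  | e + 1, y, d => if y = 1 then d else climb q e (y ^ q) (d * q)

/-- Second loop of the stack-based algorithm: pop `(y, q, e)`, let `y ← y ^ d`, and run the inner
loop, until the stack is empty. Returns the final `d`. -/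
def popLoop : List (G × ℕ × ℕ) → ℕ → ℕ
  | [], d => d
  | (y, q, e) :: S, d => popLoop S (climb q e (y ^ d) d)

/-- The stack-based algorithm for recovering `r = d * r'` from `r' = r / d` when `d` is smooth;
`none` signals failure. -/
def recoverStack (g : G) (x : ℝ) (m : ℕ) (r' : ℕ) : Option ℕ :=
  if ¬ (1 ≤ r' ∧ r' < 2 ^ m) then none
  else if g ^ r' = 1 then some r'
  else
    let yS := pushLoop x (primesUpTo x) (g ^ r') []
    if yS.1 ≠ 1 then none else some (popLoop yS.2 1 * r')

/-- `∏_{q ∈ F} q ^ ⌊log_q x⌋` -/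
def primePowerProd (x : ℝ) (F : List ℕ) : ℕ := (F.map fun q => q ^ maxExp x q).prod

/-- The recursive function of the tree-based algorithm: split `F` into a left half (of length
`⌊l / 2⌋`) and a right half, and recurse with `y` raised to the product of the prime powers of the
opposite half. -/
def treeSplit (x : ℝ) (y : G) : List ℕ → List (ℕ × G)
  | [] => []
  | [q] => [(q, y)]
  | q₁ :: q₂ :: qs =>
    let F := q₁ :: q₂ :: qs
    let FL := F.take (F.length / 2)
    let FR := F.drop (F.length / 2)
    treeSplit x (y ^ primePowerProd x FR) FL ++ treeSplit x (y ^ primePowerProd x FL) FR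
termination_by F => F.length
decreasing_by all_goals simp; omega

/-- While `y ≠ 1`: fail if the exponent budget `e` is exhausted, otherwise let `y ← y ^ q` and
`d ← d * q`. Returns the final `d`. -/
def climbOrFail (q : ℕ) : ℕ → G → ℕ → Option ℕ
  | 0, y, d => if y = 1 then some d else none
  | e + 1, y, d => if y = 1 then some d else climbOrFail q e (y ^ q) (d * q)

/-- The second loop of the tree-based algorithm, over the pairs `(q, y)`. -/
def treeLoop (x : ℝ) : List (ℕ × G) → ℕ → Option ℕ
  | [], d => some d
  | (q, y) :: T, d => (climbOrFail q (maxExp x q) y d).bind (treeLoop x T)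

/-- The tree-based algorithm for recovering `r = d * r'` from `r' = r / d` when `d` is smooth;
`none` signals failure. -/
def recoverTree (g : G) (x : ℝ) (m : ℕ) (r' : ℕ) : Option ℕ :=
  if ¬ (1 ≤ r' ∧ r' < 2 ^ m) then none
  else (treeLoop x (treeSplit x (g ^ r') (primesUpTo x)) 1).map (· * r')

/-- The filter for candidates: keep the `r'` in `[1, 2 ^ m)` with `(g ^ e) ^ r' = 1`, where
`e = ∏_{q ≤ x prime} q ^ ⌊log_q x⌋`. -/
def filterCandidates (g : G) (x : ℝ) (m : ℕ) (S : Finset ℕ) : Finset ℕ :=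
  S.filter fun r' => (1 ≤ r' ∧ r' < 2 ^ m) ∧ (g ^ primePowerProd x (primesUpTo x)) ^ r' = 1

end Recover

/-! ### The complete post-processing -/

/-- The candidates obtained by solving `j, j ± 1, …, j ± B`. -/
def candidates (solve : ℤ → ℕ) (B : ℕ) (j : ℤ) : Finset ℕ :=
  (Finset.Icc (-(B : ℤ)) B).image fun t => solve (j + t)

/-- The minimum of the values recovered from the candidates in `S`; `⊤` if there are none. -/
def minRecovered (recover : ℕ → Option ℕ) (S : Finset ℕ) : WithTop ℕ :=
  (Finset.eraseNone (S.image recover)).min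

/-- The probability that a single run of the quantum part with an `n`-bit exponent, followed by the
post-processing that solves the offsets up to `B` with `solve`, prepares the set of candidates with
`prep`, passes each of the remaining candidates to `recover` and takes the minimum of the outputs,
returns `r`. -/
def successProb {G : Type*} [Group G] [Fintype G] [DecidableEq G] (g : G) (n r B : ℕ)
    (solve : ℤ → ℕ) (prep : Finset ℕ → Finset ℕ) (recover : ℕ → Option ℕ) : ℝ :=
  ∑ j ∈ (Finset.univ : Finset (Fin (2 ^ n))).filter (fun j : Fin (2 ^ n) =>
      minRecovered recover (prep (candidates solve B ((j : ℕ) : ℤ))) = (r : WithTop ℕ)),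
    freqProb g n j

/-- `(1 - (1/π²) (2/B + 1/B² + 1/(3B³)) - π² r (2B+1) / 2^(m+ℓ)) (1 - 1 / (c log₂ (cm)))` -/
def successBound (r m ℓ B : ℕ) (c : ℝ) : ℝ :=
  (1 - 1 / Real.pi ^ 2 * (2 / (B : ℝ) + 1 / (B : ℝ) ^ 2 + 1 / (3 * (B : ℝ) ^ 3))
      - Real.pi ^ 2 * r * (2 * (B : ℝ) + 1) / 2 ^ (m + ℓ)) *
    (1 - 1 / (c * Real.logb 2 (c * m)))

end

end OrderFinding

namespace OrderFinding
open GenContFract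

/-! Write `N = 2 ^ n`, `x = c * m`, and `E` for the product of the prime powers. The measured
frequency concentrates near the multiples `z N / r`, `0 ≤ z < r`. If it lies at offset `t`, `|t| ≤
B`, from the integer nearest to such a multiple (modulo `N`), then undoing `t` gives a frequency at
which both solvers return exactly `r / gcd(z, r)`: by Legendre's theorem (`cfSolver_eq_den`), or by
a determinant argument (`latticeSolver_eq_den`). Uniqueness rests on `r ^ 2 < N`.

The two recovery algorithms compute the same function of a candidate `ρ` in range: the order of `g ^
ρ` times `ρ` if `g ^ (ρ E) = 1`, and failure otherwise (`recoverStack_eq`, `recoverTree_eq`). Every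
such value is a positive multiple of `r`, so wrong candidates cannot spoil the minimum, and `r` is
found as soon as `gcd(z, r)` divides `E`.

Two estimates remain. If `gcd(z, r)` does not divide `E`, then `z` is divisible by some prime power
exceeding `x` that divides `r`; at most `m / log x` primes are involved and each excludes at most `r
/ x` of the `z`, a fraction of at most `1 / (c log x)` in all (`card_filter_not_dvd_le`). For fixed
`z`, the probability of a frequency at distance `u` from `z N / r` is at least `sinc(π u)² / r - 3 /
N` (`freqProb_ge`). By Parseval the squares of `sinc` over a full shifted integer lattice sum to 1,
and the tails beyond `B` telescope to `2 / (π² B)` (`sum_sinc_sq_ge`). The windows of different `z`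
are disjoint because `2B + 1 < N / r`, so the bounds add up over the good `z`. The result is
slightly stronger than claimed: no `1/B²` and `1/B³` terms, and 3 in place of `π²`. -/

/-! ### Continued fractions -/

theorem ratCast_convs_of (x : ℚ) (n : ℕ) :
    (((GenContFract.of x).convs n : ℚ) : ℝ) = (GenContFract.of (x : ℝ)).convs n := by
  induction n generalizing x with
  | zero => simp
  | succ n ih =>
    rw [convs_succ, convs_succ]
    have h := ih (Int.fract x)⁻¹
    push_cast at h ⊢
    rw [h, Rat.floor_cast]

theorem den_pos_of_not_terminatedAt {x : ℚ} {k : ℕ}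
    (h : ¬ (GenContFract.of x).TerminatedAt k) : 0 < ((GenContFract.of x).contsAux (k + 1)).b := by
  have h1 : ¬ (GenContFract.of x).TerminatedAt (k + 1 - 2) :=
    mt (terminated_stable (by omega)) h
  have h2 : ((Nat.fib (k + 1) : ℕ) : ℚ) ≤ ((GenContFract.of x).contsAux (k + 1)).b :=
    fib_le_of_contsAux_b (Or.inr h1)
  exact lt_of_lt_of_le (by exact_mod_cast Nat.fib_pos.2 k.succ_pos) h2

/-- With `B_k` the denominators, `b` the next partial quotient and `f` the next fractional part, put
`X = (b + f) B_k + B_{k-1}`. The two errors are `1 / (B_k X)` and `1 / (B_{k+1} f⁻¹ X)`, where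
`B_{k+1} ≥ B_k` and `f⁻¹ ≥ 1`. -/
theorem abs_sub_convs_succ_le (x : ℚ) (k : ℕ) :
    |x - (GenContFract.of x).convs (k + 1)| ≤ |x - (GenContFract.of x).convs k| := by
  by_cases hk : (GenContFract.of x).TerminatedAt k
  · rw [convs_stable_of_terminated k.le_succ hk]
  obtain ⟨gp, hgp⟩ : ∃ gp, (GenContFract.of x).s.get? k = some gp :=
    Option.ne_none_iff_exists'.1 hk
  obtain ⟨i', hi', hb'⟩ := IntFractPair.exists_succ_get?_stream_of_gcf_of_get?_eq_some hgp
  obtain ⟨i, hi, hne, hi2⟩ := IntFractPair.succ_nth_stream_eq_some_iff.1 hi'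
  have ha : gp.a = 1 := of_partNum_eq_one (partNum_eq_s_a hgp)
  have e0 := sub_convs_eq hi
  have e1 := sub_convs_eq hi'
  have hrec := contsAux_recurrence hgp rfl rfl
  have hB0 := den_pos_of_not_terminatedAt hk
  have hpB : 0 ≤ ((GenContFract.of x).contsAux k).b := zero_le_of_contsAux_b
  have hb1 : 1 ≤ gp.b := of_one_le_get?_partDen (partDen_eq_s_b hgp)
  have hfl : i.fr⁻¹ = gp.b + i'.fr := by
    rw [← hb', ← hi2]; simp [IntFractPair.of]
  have hf0 := IntFractPair.nth_stream_fr_nonneg hi'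
  have hf1 := IntFractPair.nth_stream_fr_lt_one hi'
  simp only [hne, if_false] at e0
  rw [e0, e1]
  split_ifs with h0
  · simp
  have hf : 0 < i'.fr := lt_of_le_of_ne hf0 (Ne.symm h0)
  rw [hrec, ha, hfl]
  simp only
  generalize ((GenContFract.of x).contsAux (k + 1)).b = b1 at *
  generalize ((GenContFract.of x).contsAux k).b = b0 at *
  rw [abs_div, abs_div, abs_pow, abs_pow, abs_neg, abs_one, one_pow, one_pow]
  have hb : b1 ≤ gp.b * b1 + 1 * b0 := by nlinarith
  have hX : 0 < (gp.b + i'.fr) * b1 + b0 := by positivity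
  have hkey : i'.fr⁻¹ * (gp.b * b1 + 1 * b0) + b1 = i'.fr⁻¹ * ((gp.b + i'.fr) * b1 + b0) := by
    field_simp; ring
  rw [hkey, abs_of_pos (by positivity), abs_of_pos (by positivity)]
  have h1 : (1 : ℚ) ≤ i'.fr⁻¹ := (one_le_inv₀ hf).2 hf1.le
  gcongr
  nlinarith

theorem antitone_abs_sub_convs (x : ℚ) :
    Antitone fun k => |x - (GenContFract.of x).convs k| :=
  antitone_nat_of_succ_le (abs_sub_convs_succ_le x)

theorem eq_of_abs_sub_lt {p q : ℚ} (h : |p - q| * (p.den * q.den) < 1) : p = q := by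
  by_contra hne
  have hp : (0 : ℚ) < p.den := by exact_mod_cast p.pos
  have hq : (0 : ℚ) < q.den := by exact_mod_cast q.pos
  have e : (p - q) * (p.den * q.den) = ((p.num * q.den - q.num * p.den : ℤ) : ℚ) := by
    push_cast
    calc (p - q) * (p.den * q.den) = (p * p.den) * q.den - (q * q.den) * p.den := by ring
      _ = _ := by rw [Rat.mul_den_eq_num, Rat.mul_den_eq_num]
  have h2 : |(p - q) * (p.den * q.den)| < 1 := by
    rw [abs_mul, abs_of_pos (mul_pos hp hq)]; exact h
  rw [e] at h2
  have h3 : |p.num * q.den - q.num * p.den| < 1 := by exact_mod_cast h2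
  rw [Int.abs_lt_one_iff] at h3
  rw [h3] at e
  rcases mul_eq_zero.1 e with h4 | h4
  · exact hne (sub_eq_zero.1 h4)
  · exact absurd h4 (by positivity)

/-- Legendre's theorem supplies an arbitrary index, possibly past termination. Convergents are
constant from there on, so the same value occurs at an index over which the solver searches. -/
theorem exists_mem_convergentIndices (x : ℚ) (k : ℕ) :
    ∃ i ∈ convergentIndices x, (GenContFract.of x).convs i = (GenContFract.of x).convs k := by
  induction k with
  | zero => exact ⟨0, Or.inl rfl, rfl⟩
  | succ k ih =>
    by_cases hk : (GenContFract.of x).TerminatedAt k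
    · rwa [convs_stable_of_terminated k.le_succ hk]
    · exact ⟨k + 1, Or.inr (by simpa using hk), rfl⟩

theorem bddAbove_convergentIndices (x : ℚ) : BddAbove (convergentIndices x) := by
  obtain ⟨t, ht⟩ := terminates_of_rat x
  refine ⟨t, fun k hk => ?_⟩
  by_contra hlt
  rcases hk with rfl | hk
  · omega
  · exact hk (terminated_stable (by omega) ht)

/-- A close approximation with a small denominator is found from the continued fraction. -/
theorem cfSolver_eq_den {n : ℕ} {j : ℤ} {q : ℚ} (hq : q.den ^ 2 < 2 ^ n)
    (h : 2 * |j * q.den - q.num * 2 ^ n| ≤ (q.den : ℤ)) : cfSolver n j = q.den := by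
  set x : ℚ := (j : ℚ) / 2 ^ n with hx
  have hN : (0 : ℚ) < 2 ^ n := by positivity
  have hd : (0 : ℚ) < q.den := by exact_mod_cast q.pos
  have hq' : (q.den : ℚ) ^ 2 < 2 ^ n := by exact_mod_cast hq
  have hclose : |x - q| ≤ 1 / (2 * 2 ^ n) := by
    have e : x - q = ((j * q.den - q.num * 2 ^ n : ℤ) : ℚ) / (2 ^ n * q.den) := by
      rw [hx]; push_cast
      conv_lhs => rw [← Rat.num_div_den q]
      field_simp
    have h' : 2 * |((j * q.den - q.num * 2 ^ n : ℤ) : ℚ)| ≤ q.den := by exact_mod_cast h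
    rw [e, abs_div, abs_of_pos (by positivity : (0 : ℚ) < 2 ^ n * q.den), div_le_div_iff₀
      (by positivity) (by positivity)]
    nlinarith
  have hleg : |(x : ℝ) - q| < 1 / (2 * (q.den : ℝ) ^ 2) := by
    have : |x - q| < 1 / (2 * (q.den : ℚ) ^ 2) := lt_of_le_of_lt hclose (by gcongr)
    have h2 := (Rat.cast_lt (K := ℝ)).2 this
    push_cast at h2
    exact h2
  obtain ⟨k, hk⟩ := Real.exists_convs_eq_rat hleg
  rw [← ratCast_convs_of] at hk
  have hk' : (GenContFract.of x).convs k = q := by exact_mod_cast hk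
  obtain ⟨i, hi, hik⟩ := exists_mem_convergentIndices x k
  rw [hk'] at hik
  set S := {k ∈ convergentIndices x | convergentDen x k ^ 2 < 2 ^ n}
  have hiS : i ∈ S := ⟨hi, by rw [convergentDen, hik]; exact hq⟩
  -- Boundedness matters: `sSup` of an unbounded set of naturals would be the default 0.
  have hbdd : BddAbove S := (bddAbove_convergentIndices x).mono (fun _ h => h.1)
  have hmem : sSup S ∈ S := Nat.sSup_mem ⟨i, hiS⟩ hbdd
  have hle : i ≤ sSup S := le_csSup hbdd hiS
  change convergentDen x (sSup S) = q.den
  obtain ⟨-, hden⟩ := hmem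
  rw [convergentDen] at hden ⊢
  set p := (GenContFract.of x).convs (sSup S) with hp
  -- The last admissible convergent `p` comes no earlier than `q`, so both lie within `1 / (2 * 2 ^
  -- n)` of `x`. Distinct fractions whose denominators have product below `2 ^ n` are more than `1 /
  -- 2 ^ n` apart.
  have hp1 : |x - p| ≤ |x - q| := by
    have := antitone_abs_sub_convs x hle
    simpa only [hik] using this
  have hden' : (p.den : ℚ) ^ 2 < 2 ^ n := by exact_mod_cast hden
  suffices p = q by rw [this]
  apply eq_of_abs_sub_lt
  have h1 : |p - q| ≤ 1 / 2 ^ n := by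
    have : |p - q| ≤ |x - p| + |x - q| := by
      rw [abs_sub_comm x p]; exact abs_sub_le p x q
    have e : (1 : ℚ) / 2 ^ n = 1 / (2 * 2 ^ n) + 1 / (2 * 2 ^ n) := by field_simp; norm_num
    rw [e]; linarith
  have hpd : (0 : ℚ) < p.den := by exact_mod_cast p.pos
  have h2 : (p.den * q.den : ℚ) < 2 ^ n := by nlinarith [sq_nonneg ((p.den : ℚ) - q.den)]
  calc |p - q| * (p.den * q.den) ≤ 1 / 2 ^ n * (p.den * q.den) := by gcongr
    _ < 1 / 2 ^ n * 2 ^ n := by gcongr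
    _ = 1 := by field_simp

/-! ### Shortest vectors of the frequency lattice -/

theorem mem_freqLattice {n : ℕ} {j : ℤ} {w : EuclideanSpace ℝ (Fin 2)} :
    w ∈ freqLattice n j ↔ ∃ a b : ℤ, w 0 = a * j + b * 2 ^ n ∧ w 1 = a / 2 := by
  rw [freqLattice, Submodule.mem_span_pair]
  refine exists_congr fun a => exists_congr fun b => ?_
  constructor
  · rintro rfl
    simp [div_eq_mul_inv]
  · rintro ⟨h0, h1⟩
    ext i
    fin_cases i
    · simp [h0]
    · simp [h1, div_eq_mul_inv]

/-- A close approximation with a small denominator is found from the lattice. -/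
theorem latticeSolver_eq_den {n : ℕ} {solve : ℤ → ℕ} (hs : IsLatticeSolver n solve)
    {j : ℤ} {q : ℚ} (hq : q.den ^ 2 < 2 ^ n)
    (h : 2 * |j * q.den - q.num * 2 ^ n| ≤ (q.den : ℤ)) : solve j = q.den := by
  obtain ⟨s, ⟨hsL, hs0, hmin⟩, hval⟩ := hs j
  obtain ⟨a, b, ha, hb⟩ := mem_freqLattice.1 hsL
  set w : EuclideanSpace ℝ (Fin 2) := !₂[((j * q.den - q.num * 2 ^ n : ℤ) : ℝ), (q.den : ℝ) / 2]
    with hw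
  have hwL : w ∈ freqLattice n j :=
    mem_freqLattice.2 ⟨q.den, -q.num, by simp [hw]; ring, by simp [hw]⟩
  have hd : (0 : ℝ) < q.den := by exact_mod_cast q.pos
  have hq' : (q.den : ℝ) ^ 2 < 2 ^ n := by exact_mod_cast hq
  have hw0 : w ≠ 0 := by
    intro h0
    have := congrArg (fun v : EuclideanSpace ℝ (Fin 2) => v 1) h0
    simp [hw] at this
  have hns : ‖s‖ ^ 2 = (a * j + b * 2 ^ n) ^ 2 + (a / 2 : ℝ) ^ 2 := by
    rw [EuclideanSpace.norm_sq_eq, Fin.sum_univ_two, ha, hb]; simp [div_pow]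
  have hnw : ‖w‖ ^ 2 = (j * q.den - q.num * 2 ^ n : ℝ) ^ 2 + (q.den / 2 : ℝ) ^ 2 := by
    rw [EuclideanSpace.norm_sq_eq, Fin.sum_univ_two]; simp [hw]
  have hle : ‖s‖ ^ 2 ≤ ‖w‖ ^ 2 := by gcongr; exact hmin w hwL hw0
  have h' : 2 * |(j * q.den - q.num * 2 ^ n : ℝ)| ≤ q.den := by exact_mod_cast h
  have hsq : 4 * (j * q.den - q.num * 2 ^ n : ℝ) ^ 2 ≤ (q.den : ℝ) ^ 2 := by
    rw [← sq_abs (j * q.den - q.num * 2 ^ n : ℝ)]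
    nlinarith [abs_nonneg (j * q.den - q.num * 2 ^ n : ℝ)]
  -- Twice the determinant of `s` and `w` is, up to sign, `2 ^ n` times this integer. Hadamard's
  -- inequality (the square supplied to `nlinarith` is that of the inner product, scaled) with `‖s‖²
  -- ≤ ‖w‖² ≤ q.den² / 2` bounds it by `q.den² < 2 ^ n`, so the integer vanishes and `s` is parallel
  -- to `w`.
  have hdet : b * q.den + q.num * a = 0 := by
    have key : ((2 : ℝ) ^ n * (b * q.den + q.num * a)) ^ 2 < (2 ^ n) ^ 2 := by
      have e : ((2 : ℝ) ^ n * (b * q.den + q.num * a)) =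
          (a * j + b * 2 ^ n) * q.den - (j * q.den - q.num * 2 ^ n) * a := by ring
      have cs : ((a * j + b * 2 ^ n) * q.den - (j * q.den - q.num * 2 ^ n) * a : ℝ) ^ 2 ≤
          4 * (‖s‖ ^ 2 * ‖w‖ ^ 2) := by
        rw [hns, hnw]
        nlinarith [sq_nonneg (4 * (a * j + b * 2 ^ n) * (j * q.den - q.num * 2 ^ n)
          + a * q.den : ℝ)]
      have hw2 : ‖w‖ ^ 2 ≤ (q.den : ℝ) ^ 2 / 2 := by rw [hnw]; nlinarith
      rw [e]
      have : ‖s‖ ^ 2 * ‖w‖ ^ 2 ≤ ((q.den : ℝ) ^ 2 / 2) * ((q.den : ℝ) ^ 2 / 2) := by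
        gcongr; exact hle.trans hw2
      nlinarith [sq_nonneg (q.den : ℝ)]
    rw [mul_pow] at key
    have : ((b * q.den + q.num * a : ℝ)) ^ 2 < 1 := by
      by_contra hc
      have : (2 ^ n : ℝ) ^ 2 * 1 ≤ (2 ^ n) ^ 2 * (b * q.den + q.num * a) ^ 2 := by
        gcongr; linarith
      linarith
    have h2 : (b * q.den + q.num * a) ^ 2 < 1 := by exact_mod_cast this
    have h3 : (b * q.den + q.num * a) ^ 2 = 0 := by
      have := sq_nonneg (b * q.den + q.num * a); omega
    exact pow_eq_zero_iff (two_ne_zero) |>.1 h3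
  -- Since `q` is in lowest terms, `w` is primitive: `s = k w` with `k` an integer, and minimality
  -- leaves `k = ±1`.
  have hdvd : (q.den : ℤ) ∣ a := by
    have hc : IsCoprime (q.den : ℤ) q.num := by
      rw [Int.isCoprime_iff_nat_coprime]; simpa using q.reduced.symm
    exact hc.dvd_of_dvd_mul_left ⟨-b, by linarith⟩
  obtain ⟨k, rfl⟩ := hdvd
  have hdz : (q.den : ℤ) ≠ 0 := by exact_mod_cast q.pos.ne'
  have hbk : b = -(q.num * k) := by
    apply mul_right_cancel₀ hdz; linarith
  have hk0 : k ≠ 0 := by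
    rintro rfl
    apply hs0
    have hb0 : b = 0 := by simpa using hbk
    ext i
    fin_cases i
    · simpa [hb0] using ha
    · simpa using hb
  have hsk : ‖s‖ ^ 2 = k ^ 2 * ‖w‖ ^ 2 := by
    rw [hns, hnw, hbk]; push_cast; ring
  have hwpos : 0 < ‖w‖ ^ 2 := by positivity
  have hk1 : (k : ℝ) ^ 2 ≤ 1 := by
    by_contra hc
    nlinarith
  have hk2 : |k| = 1 := by
    have h1 : k ^ 2 ≤ 1 := by exact_mod_cast hk1
    have h2 : |k| ≤ 1 := by simpa [sq_le_one_iff_abs_le_one] using h1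
    have h3 := abs_pos.2 hk0
    omega
  have : (solve j : ℝ) = q.den := by
    rw [hval, hb]
    push_cast
    rw [abs_div, abs_mul, ← Int.cast_abs, hk2]
    simp [mul_div_cancel₀]
  exact_mod_cast this

/-! ### The recovery algorithms compute element orders -/

theorem mem_primesUpTo {x : ℝ} {q : ℕ} (hx : 0 ≤ x) :
    q ∈ primesUpTo x ↔ q.Prime ∧ (q : ℝ) ≤ x := by
  simp [primesUpTo, Nat.le_floor_iff hx, and_comm]

theorem prime_of_mem_primesUpTo {x : ℝ} {q : ℕ} (h : q ∈ primesUpTo x) : q.Prime := by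
  simpa using (List.mem_filter.1 h).2

theorem nodup_primesUpTo (x : ℝ) : (primesUpTo x).Nodup :=
  List.nodup_range.filter _

/-- The two factors divide `a` and `b`, so they are coprime divisors of the order of `y`.
Conversely, raising `y` to their product gives an element whose order divides both `a` and `b`. -/
theorem orderOf_pow_mul_orderOf_pow_of_coprime {G : Type*} [Group G] [Finite G] {a b : ℕ} (hab : a.Coprime b) (y : G)
    (h : y ^ (a * b) = 1) : orderOf (y ^ b) * orderOf (y ^ a) = orderOf y := by
  have ha : orderOf (y ^ b) ∣ a := orderOf_dvd_of_pow_eq_one (by rw [← pow_mul, mul_comm, h])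
  have hb : orderOf (y ^ a) ∣ b := orderOf_dvd_of_pow_eq_one (by rw [← pow_mul, h])
  apply Nat.dvd_antisymm
  · exact (Nat.Coprime.coprime_dvd_left ha (hab.coprime_dvd_right hb)).mul_dvd_of_dvd_of_dvd
      (orderOf_pow_dvd _) (orderOf_pow_dvd _)
  · apply orderOf_dvd_of_pow_eq_one
    set k := orderOf (y ^ b) * orderOf (y ^ a)
    have h1 : orderOf (y ^ k) ∣ b := orderOf_dvd_of_pow_eq_one (by
      rw [← pow_mul, mul_comm, pow_mul]
      exact orderOf_dvd_iff_pow_eq_one.1 (dvd_mul_right _ _))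
    have h2 : orderOf (y ^ k) ∣ a := orderOf_dvd_of_pow_eq_one (by
      rw [← pow_mul, mul_comm, pow_mul]
      exact orderOf_dvd_iff_pow_eq_one.1 (dvd_mul_left _ _))
    exact orderOf_eq_one_iff.1 (Nat.dvd_one.1 (hab ▸ Nat.dvd_gcd h2 h1))

theorem primePowerProd_append (x : ℝ) (F F' : List ℕ) :
    primePowerProd x (F ++ F') = primePowerProd x F * primePowerProd x F' := by
  simp [primePowerProd]

theorem primePowerProd_cons (x : ℝ) (q : ℕ) (F : List ℕ) :
    primePowerProd x (q :: F) = q ^ maxExp x q * primePowerProd x F := by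
  simp [primePowerProd]

theorem coprime_primePowerProd {x : ℝ} {a : ℕ} {F : List ℕ} (h : ∀ q ∈ F, a.Coprime q) :
    a.Coprime (primePowerProd x F) := by
  induction F with
  | nil => simp [primePowerProd]
  | cons q F ih =>
    rw [primePowerProd_cons]
    exact Nat.Coprime.mul_right ((h q (by simp)).pow_right _) (ih fun q' h' => h q' (by simp [h']))

theorem coprime_primePowerProd_of_disjoint {x : ℝ} {F F' : List ℕ} (hF : ∀ q ∈ F, q.Prime)
    (hF' : ∀ q ∈ F', q.Prime) (hd : F.Disjoint F') :
    (primePowerProd x F).Coprime (primePowerProd x F') := by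
  refine coprime_primePowerProd fun q' hq' => (coprime_primePowerProd fun q hq => ?_).symm
  rw [Nat.coprime_primes (hF' q' hq') (hF q hq)]
  rintro rfl
  exact hd hq hq'

section Group

variable {G : Type*} [Group G] [DecidableEq G]

/-- The order of `y` is a power of `q`, and each round divides it by `q` while multiplying `d` by
`q`. -/
theorem climb_eq {q : ℕ} (e : ℕ) (y : G) (d : ℕ) (hq : q.Prime) (hy : y ^ q ^ e = 1) :
    climb q e y d = d * orderOf y := by
  induction e generalizing y d with
  | zero => simp only [pow_zero, pow_one] at hy; simp [climb, hy]
  | succ e ih =>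
    rw [climb]
    split_ifs with h1
    · simp [h1]
    · rw [ih _ _ (by rw [← pow_mul, ← pow_succ', hy]), mul_assoc]
      congr 1
      obtain ⟨k, hk, hk'⟩ := (Nat.dvd_prime_pow hq).1 (orderOf_dvd_of_pow_eq_one hy)
      cases k with
      | zero => exact absurd (orderOf_eq_one_iff.1 (by simpa using hk')) h1
      | succ k =>
        have hfin : q ∣ orderOf y := by rw [hk']; exact dvd_pow_self _ (by omega)
        rw [orderOf_pow_of_dvd hq.ne_zero hfin, Nat.mul_div_cancel' hfin]

theorem climbOrFail_eq {q : ℕ} (e : ℕ) (y : G) (d : ℕ) (hq : q.Prime) :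
    climbOrFail q e y d = if y ^ q ^ e = 1 then some (d * orderOf y) else none := by
  induction e generalizing y d with
  | zero =>
    rw [climbOrFail]
    simp only [pow_zero, pow_one]
    split_ifs with h1 <;> simp [h1]
  | succ e ih =>
    rw [climbOrFail]
    by_cases h1 : y = 1
    · simp [h1]
    · rw [if_neg h1, ih, ← pow_mul, ← pow_succ']
      split_ifs with h2
      · obtain ⟨k, hk, hk'⟩ := (Nat.dvd_prime_pow hq).1 (orderOf_dvd_of_pow_eq_one h2)
        cases k with
        | zero => exact absurd (orderOf_eq_one_iff.1 (by simpa using hk')) h1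
        | succ k =>
          have hfin : q ∣ orderOf y := by rw [hk']; exact dvd_pow_self _ (by omega)
          rw [orderOf_pow_of_dvd hq.ne_zero hfin, mul_assoc, Nat.mul_div_cancel' hfin]
      · rfl

/-- One round of the stack-based algorithm: if `d` is the order of `y ^ (q ^ e)`, then climbing from
`y ^ d` yields the order of `y`. -/
theorem climb_pow_orderOf [Finite G] {q e : ℕ} (hq : q.Prime) (y : G) :
    climb q e (y ^ orderOf (y ^ q ^ e)) (orderOf (y ^ q ^ e)) = orderOf y := by
  have h : (y ^ orderOf (y ^ q ^ e)) ^ q ^ e = 1 := by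
    rw [← pow_mul, mul_comm, pow_mul, pow_orderOf_eq_one]
  rw [climb_eq _ _ _ hq h]
  have hd : orderOf (y ^ q ^ e) ∣ orderOf y := orderOf_pow_dvd _
  rw [orderOf_pow_of_dvd (orderOf_pos _).ne' hd, Nat.mul_div_cancel' hd]

/-- Invariant: when `(y, q, e)` is popped, `d` is the order of `y ^ q ^ e`, which is the element
pushed next, or the final 1. -/
theorem popLoop_pushLoop [Finite G] (x : ℝ) (F : List ℕ) (y : G) (S : List (G × ℕ × ℕ))
    (hF : ∀ q ∈ F, q.Prime) (h : (pushLoop x F y S).1 = 1) :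
    popLoop (pushLoop x F y S).2 1 = popLoop S (orderOf y) := by
  induction F generalizing y S with
  | nil => simp only [pushLoop] at h; simp [pushLoop, h]
  | cons q F ih =>
    have hq := hF q (by simp)
    simp only [pushLoop] at h ⊢
    split_ifs at h ⊢ with h1
    · have := climb_pow_orderOf (e := maxExp x q) hq y
      rw [h1, orderOf_one] at this
      simp only [popLoop, this]
    · rw [ih _ _ (fun q' hq' => hF q' (by simp [hq'])) h, popLoop, climb_pow_orderOf hq]

theorem pushLoop_fst_eq_one_iff (x : ℝ) (F : List ℕ) (y : G) (S : List (G × ℕ × ℕ)) :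
    (pushLoop x F y S).1 = 1 ↔ y ^ primePowerProd x F = 1 := by
  induction F generalizing y S with
  | nil => simp [pushLoop, primePowerProd]
  | cons q F ih =>
    have e : y ^ primePowerProd x (q :: F) = (y ^ q ^ maxExp x q) ^ primePowerProd x F := by
      rw [← pow_mul]; simp [primePowerProd]
    simp only [pushLoop]
    rw [e]
    split_ifs with h1
    · simp [h1]
    · exact ih _ _

theorem recoverStack_eq [Finite G] (g : G) (x : ℝ) (m r' : ℕ) :
    recoverStack g x m r' =
      if (1 ≤ r' ∧ r' < 2 ^ m) ∧ (g ^ r') ^ primePowerProd x (primesUpTo x) = 1 then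
        some (orderOf (g ^ r') * r') else none := by
  rw [recoverStack]
  by_cases h : 1 ≤ r' ∧ r' < 2 ^ m
  · simp only [h, not_true, if_false, true_and]
    by_cases h1 : g ^ r' = 1
    · simp [h1]
    · rw [if_neg h1]
      have hiff := pushLoop_fst_eq_one_iff x (primesUpTo x) (g ^ r') []
      by_cases h2 : (g ^ r') ^ primePowerProd x (primesUpTo x) = 1
      · have h3 := hiff.2 h2
        simp only [h3, h2, ne_eq, not_true, if_false, if_true]
        rw [popLoop_pushLoop x _ _ _ (fun q hq => prime_of_mem_primesUpTo hq) h3, popLoop]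
      · have h3 := mt hiff.1 h2
        simp [h3, h2]
  · simp [h]

theorem treeLoop_append (x : ℝ) (T T' : List (ℕ × G)) (d : ℕ) :
    treeLoop x (T ++ T') d = (treeLoop x T d).bind (treeLoop x T') := by
  induction T generalizing d with
  | nil => simp [treeLoop]
  | cons p T ih =>
    obtain ⟨q, y⟩ := p
    simp only [List.cons_append, treeLoop, Option.bind_assoc]
    congr 1
    funext d'
    exact ih d'

/-- The prime powers of the two halves are coprime, so the order of `y` is the product of the orders
passed down to the halves. An empty list must be excluded: its loop succeeds without testing `y =
1`. -/
theorem treeLoop_treeSplit [Finite G] (x : ℝ) (y : G) (F : List ℕ) (hF : ∀ q ∈ F, q.Prime)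
    (hnd : F.Nodup) (hne : F ≠ []) (d : ℕ) :
    treeLoop x (treeSplit x y F) d =
      if y ^ primePowerProd x F = 1 then some (d * orderOf y) else none := by
  induction hl : F.length using Nat.strong_induction_on generalizing F y d with
  | _ l ih =>
  subst hl
  match F, hne with
  | [q], _ =>
    rw [treeSplit, treeLoop, climbOrFail_eq _ _ _ (hF q (by simp))]
    simp only [primePowerProd_cons]
    simp only [primePowerProd, List.map_nil, List.prod_nil, mul_one]
    split_ifs <;> simp [treeLoop]
  | q₁ :: q₂ :: qs, _ =>
    rw [treeSplit]
    set F := q₁ :: q₂ :: qs with hFdef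
    have hlen : 2 ≤ F.length := by simp [hFdef]
    set FL := F.take (F.length / 2) with hFL
    set FR := F.drop (F.length / 2) with hFR
    have hLl : FL.length = F.length / 2 := by simp [hFL]; omega
    have hRl : FR.length = F.length - F.length / 2 := by simp [hFR]
    have happ : FL ++ FR = F := List.take_append_drop _ _
    have hLp : ∀ q ∈ FL, q.Prime := fun q hq => hF q (by rw [← happ]; simp [hq])
    have hRp : ∀ q ∈ FR, q.Prime := fun q hq => hF q (by rw [← happ]; simp [hq])
    have hnd' := hnd
    rw [← happ, List.nodup_append'] at hnd'
    obtain ⟨hLn, hRn, hdis⟩ := hnd'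
    have hcop := coprime_primePowerProd_of_disjoint (x := x) hLp hRp hdis
    have ihL := fun y d => ih _ (by omega) y FL hLp hLn
      (List.ne_nil_of_length_pos (by omega)) d rfl
    have ihR := fun y d => ih _ (by omega) y FR hRp hRn
      (List.ne_nil_of_length_pos (by omega)) d rfl
    have hE : primePowerProd x F = primePowerProd x FL * primePowerProd x FR := by
      rw [← primePowerProd_append, happ]
    rw [treeLoop_append, ihL, ← pow_mul, mul_comm (primePowerProd x FR), ← hE]
    split_ifs with h
    · rw [Option.bind_some, ihR, ← pow_mul, ← hE, if_pos h, mul_assoc,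
        orderOf_pow_mul_orderOf_pow_of_coprime hcop y (hE ▸ h)]
    · rfl

theorem recoverTree_eq [Finite G] (g : G) {x : ℝ} (hx : 2 ≤ x) (m r' : ℕ) :
    recoverTree g x m r' =
      if (1 ≤ r' ∧ r' < 2 ^ m) ∧ (g ^ r') ^ primePowerProd x (primesUpTo x) = 1 then
        some (orderOf (g ^ r') * r') else none := by
  have hne : primesUpTo x ≠ [] := List.ne_nil_of_mem
    ((mem_primesUpTo (by linarith)).2 ⟨Nat.prime_two, by simpa using hx⟩)
  rw [recoverTree, treeLoop_treeSplit x _ _ (fun q hq => prime_of_mem_primesUpTo hq)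
    (nodup_primesUpTo x) hne]
  by_cases h : 1 ≤ r' ∧ r' < 2 ^ m
  · simp only [h, not_true, if_false, true_and, and_self]
    split_ifs <;> simp
  · simp [h]

end Group

/-! ### Counting the peaks with a smooth gcd -/

theorem lt_pow_maxExp_succ {x : ℝ} {q : ℕ} (hx : 0 < x) (hq : 2 ≤ q) :
    x < (q : ℝ) ^ (maxExp x q + 1) := by
  have hq1 : (1 : ℝ) < q := by exact_mod_cast hq
  rw [← Real.rpow_natCast, ← Real.logb_lt_iff_lt_rpow hq1 hx]
  exact_mod_cast Nat.lt_floor_add_one (Real.logb q x)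

theorem maxExp_eq_zero {x : ℝ} {q : ℕ} (hx : 0 < x) (hq : 2 ≤ q) (h : x < q) :
    maxExp x q = 0 := by
  have hq1 : (1 : ℝ) < q := by exact_mod_cast hq
  rw [maxExp, Nat.floor_eq_zero, Real.logb_lt_iff_lt_rpow hq1 hx, Real.rpow_one]
  exact h

theorem pow_dvd_primePowerProd {x : ℝ} {q k : ℕ} (hx : 0 < x) (hq : q.Prime)
    (hk : k ≤ maxExp x q) : q ^ k ∣ primePowerProd x (primesUpTo x) := by
  by_cases h : (q : ℝ) ≤ x
  · exact (pow_dvd_pow q hk).trans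
      (List.dvd_prod (List.mem_map.2 ⟨q, (mem_primesUpTo hx.le).2 ⟨hq, h⟩, rfl⟩))
  · rw [maxExp_eq_zero hx hq.two_le (not_le.1 h)] at hk
    simp [Nat.le_zero.1 hk]

/-- A divisor not dividing `∏ q ^ ⌊log_q x⌋` is divisible by a prime power exceeding `x`. -/
theorem exists_pow_dvd_of_not_dvd {x : ℝ} {d : ℕ} (hx : 0 < x)
    (h : ¬ d ∣ primePowerProd x (primesUpTo x)) :
    ∃ q, q.Prime ∧ q ^ (maxExp x q + 1) ∣ d := by
  rw [Nat.dvd_iff_prime_pow_dvd_dvd] at h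
  push Not at h
  obtain ⟨p, k, hp, hd, hnd⟩ := h
  refine ⟨p, hp, (pow_dvd_pow p ?_).trans hd⟩
  by_contra hlt
  exact hnd (pow_dvd_primePowerProd hx hp (by omega))

theorem card_filter_dvd_range {k r : ℕ} (hkr : k ∣ r) :
    ((Finset.range r).filter (k ∣ ·)).card ≤ r / k := by
  have : (Finset.range r).filter (k ∣ ·) ⊆ (Finset.range (r / k)).image (k * ·) := by
    intro z hz
    obtain ⟨hz, c, rfl⟩ := Finset.mem_filter.1 hz
    refine Finset.mem_image.2 ⟨c, ?_, rfl⟩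
    rw [Finset.mem_range] at hz ⊢
    exact (Nat.lt_div_iff_mul_lt' hkr c).2 hz
  exact (Finset.card_le_card this).trans (Finset.card_image_le.trans (by simp))

/-- Few `z` are such that `gcd z r` is divisible by a prime power exceeding `x`. -/
theorem card_filter_not_dvd_le {x : ℝ} {r m : ℕ} (hx : 2 ≤ x) (hr : 0 < r) (hrm : r < 2 ^ m) :
    (((Finset.range r).filter
      fun z => ¬ Nat.gcd z r ∣ primePowerProd x (primesUpTo x)).card : ℝ) * (x * Real.logb 2 x) ≤
      r * m := by
  have hx0 : 0 < x := by linarith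
  have hlog : 0 ≤ Real.logb 2 x := Real.logb_nonneg (by norm_num) (by linarith)
  set S := r.primeFactors.filter fun q => q ^ (maxExp x q + 1) ∣ r with hS
  have hSp : ∀ q ∈ S, q.Prime := fun q hq => Nat.prime_of_mem_primeFactors (Finset.mem_filter.1 hq).1
  have hSd : ∀ q ∈ S, q ^ (maxExp x q + 1) ∣ r := fun q hq => (Finset.mem_filter.1 hq).2
  have hprod : ∏ q ∈ S, q ^ (maxExp x q + 1) ∣ r := by
    refine Finset.prod_dvd_of_isRelPrime (fun p hp q hq hne => ?_) hSd
    rw [Function.onFun, ← Nat.coprime_iff_isRelPrime]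
    exact Nat.Coprime.pow _ _ ((Nat.coprime_primes (hSp p hp) (hSp q hq)).2 hne)
  -- The powers `q ^ (maxExp x q + 1)`, `q ∈ S`, are pairwise coprime divisors of `r < 2 ^ m`, and
  -- each exceeds `x`.
  have hSm : (S.card : ℝ) * Real.logb 2 x ≤ m := by
    have h1 : x ^ S.card ≤ (2 : ℝ) ^ m := by
      calc x ^ S.card = ∏ _q ∈ S, x := by rw [Finset.prod_const]
        _ ≤ ∏ q ∈ S, (q : ℝ) ^ (maxExp x q + 1) :=
          Finset.prod_le_prod (fun _ _ => hx0.le)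
            fun q hq => (lt_pow_maxExp_succ hx0 (hSp q hq).two_le).le
        _ = ((∏ q ∈ S, q ^ (maxExp x q + 1) : ℕ) : ℝ) := by push_cast; rfl
        _ ≤ (r : ℝ) := by exact_mod_cast Nat.le_of_dvd hr hprod
        _ ≤ 2 ^ m := by exact_mod_cast hrm.le
    have h2 := Real.logb_le_logb_of_le (b := 2) (by norm_num) (by positivity) h1
    rwa [Real.logb_pow, Real.logb_pow, Real.logb_self_eq_one (by norm_num), mul_one] at h2
  have hcard : (((Finset.range r).filter
      fun z => ¬ Nat.gcd z r ∣ primePowerProd x (primesUpTo x)).card : ℝ) * x ≤ S.card * r := by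
    have hsub : ((Finset.range r).filter
        fun z => ¬ Nat.gcd z r ∣ primePowerProd x (primesUpTo x)) ⊆
        S.biUnion fun q => (Finset.range r).filter (q ^ (maxExp x q + 1) ∣ ·) := by
      intro z hz
      obtain ⟨hz, hnd⟩ := Finset.mem_filter.1 hz
      obtain ⟨q, hq, hd⟩ := exists_pow_dvd_of_not_dvd hx0 hnd
      have hdr := hd.trans (Nat.gcd_dvd_right z r)
      refine Finset.mem_biUnion.2 ⟨q, Finset.mem_filter.2 ⟨?_, hdr⟩,
        Finset.mem_filter.2 ⟨hz, hd.trans (Nat.gcd_dvd_left z r)⟩⟩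
      exact Nat.mem_primeFactors.2 ⟨hq, (dvd_pow_self q (by omega)).trans hdr, hr.ne'⟩
    have h1 := (Finset.card_le_card hsub).trans Finset.card_biUnion_le
    have h2 : (((Finset.range r).filter
        fun z => ¬ Nat.gcd z r ∣ primePowerProd x (primesUpTo x)).card : ℝ) ≤
        ∑ q ∈ S, (((Finset.range r).filter (q ^ (maxExp x q + 1) ∣ ·)).card : ℝ) := by
      exact_mod_cast h1
    calc _ ≤ (∑ q ∈ S, (((Finset.range r).filter (q ^ (maxExp x q + 1) ∣ ·)).card : ℝ)) * x := by
          gcongr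
      _ = ∑ q ∈ S, (((Finset.range r).filter (q ^ (maxExp x q + 1) ∣ ·)).card : ℝ) * x := by
          rw [Finset.sum_mul]
      _ ≤ ∑ _q ∈ S, (r : ℝ) := by
          refine Finset.sum_le_sum fun q hq => ?_
          have hpos : 0 < q ^ (maxExp x q + 1) := pow_pos (hSp q hq).pos _
          have h3 : ((Finset.range r).filter (q ^ (maxExp x q + 1) ∣ ·)).card *
              q ^ (maxExp x q + 1) ≤ r :=
            (Nat.le_div_iff_mul_le hpos).1 (card_filter_dvd_range (hSd q hq))
          calc _ ≤ (((Finset.range r).filter (q ^ (maxExp x q + 1) ∣ ·)).card : ℝ) *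
                (q : ℝ) ^ (maxExp x q + 1) := by
                gcongr; exact (lt_pow_maxExp_succ hx0 (hSp q hq).two_le).le
            _ ≤ r := by exact_mod_cast h3
      _ = S.card * r := by rw [Finset.sum_const, nsmul_eq_mul]
  calc _ = ((((Finset.range r).filter
      fun z => ¬ Nat.gcd z r ∣ primePowerProd x (primesUpTo x)).card : ℝ) * x) *
        Real.logb 2 x := by ring
    _ ≤ (S.card * r) * Real.logb 2 x := by gcongr
    _ = r * (S.card * Real.logb 2 x) := by ring
    _ ≤ r * m := by gcongr

/-! ### The minimum over all candidates -/

theorem minRecovered_eq {recover : ℕ → Option ℕ} {S : Finset ℕ} {r r' : ℕ} (hr' : r' ∈ S)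
    (h : recover r' = some r) (hmin : ∀ s ∈ S, ∀ v, recover s = some v → r ≤ v) :
    minRecovered recover S = (r : WithTop ℕ) := by
  rw [minRecovered]
  apply le_antisymm
  · exact Finset.min_le (Finset.mem_eraseNone.2 (Finset.mem_image.2 ⟨r', hr', h⟩))
  · refine Finset.le_min fun v hv => ?_
    obtain ⟨s, hs, hsv⟩ := Finset.mem_image.1 (Finset.mem_eraseNone.1 hv)
    exact WithTop.coe_le_coe.2 (hmin s hs v hsv)

section Recover

variable {G : Type*} [Group G] [DecidableEq G]

theorem recover_eq [Finite G] {g : G} {x : ℝ} (hx : 2 ≤ x) {m : ℕ} {recover : ℕ → Option ℕ}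
    (h : recover = recoverStack g x m ∨ recover = recoverTree g x m) (r' : ℕ) :
    recover r' =
      if (1 ≤ r' ∧ r' < 2 ^ m) ∧ (g ^ r') ^ primePowerProd x (primesUpTo x) = 1 then
        some (orderOf (g ^ r') * r') else none := by
  rcases h with rfl | rfl
  · exact recoverStack_eq g x m r'
  · exact recoverTree_eq g hx m r'

/-- The post-processing succeeds if one of the candidates is the quotient of the order by a divisor
without large prime powers. -/
theorem minRecovered_eq_orderOf [Finite G] {g : G} {x : ℝ} (hx : 2 ≤ x) {m : ℕ}
    (hm : orderOf g < 2 ^ m) {recover : ℕ → Option ℕ}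
    (hrec : recover = recoverStack g x m ∨ recover = recoverTree g x m)
    {prep : Finset ℕ → Finset ℕ} (hprep : prep = id ∨ prep = filterCandidates g x m)
    {S : Finset ℕ} {d : ℕ} (hd : d ∣ orderOf g) (hdE : d ∣ primePowerProd x (primesUpTo x))
    (hS : orderOf g / d ∈ S) :
    minRecovered recover (prep S) = (orderOf g : WithTop ℕ) := by
  have hpos := orderOf_pos g
  have hdpos : 0 < d := Nat.pos_of_dvd_of_pos hd hpos
  have h1 : 1 ≤ orderOf g / d := Nat.div_pos (Nat.le_of_dvd hpos hd) hdpos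
  have h2 : orderOf g / d < 2 ^ m := (Nat.div_le_self _ _).trans_lt hm
  have hord : orderOf (g ^ (orderOf g / d)) = d := by
    rw [orderOf_pow_of_dvd (by omega) (Nat.div_dvd_of_dvd hd), Nat.div_div_self hd hpos.ne']
  have h3 : (g ^ (orderOf g / d)) ^ primePowerProd x (primesUpTo x) = 1 :=
    orderOf_dvd_iff_pow_eq_one.1 (hord.symm ▸ hdE)
  refine minRecovered_eq (r' := orderOf g / d) ?_ ?_ ?_
  · rcases hprep with rfl | rfl
    · exact hS
    · refine Finset.mem_filter.2 ⟨hS, ⟨h1, h2⟩, ?_⟩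
      rw [← pow_mul, mul_comm, pow_mul, h3]
  · rw [recover_eq hx hrec, if_pos ⟨⟨h1, h2⟩, h3⟩, hord, Nat.mul_div_cancel' hd]
  · intro s _ v hv
    rw [recover_eq hx hrec] at hv
    split_ifs at hv with hc
    obtain rfl := Option.some.inj hv
    refine Nat.le_of_dvd (Nat.mul_pos (orderOf_pos _) hc.1.1) (orderOf_dvd_of_pow_eq_one ?_)
    rw [mul_comm, pow_mul, pow_orderOf_eq_one]

end Recover

/-! ### Sums of squares of `sinc` -/

theorem fourierCoeffOn_exp_eq_sinc (δ : ℝ) (t : ℤ) :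
    fourierCoeffOn (neg_lt_self Real.pi_pos)
      (fun x : ℝ => Complex.exp (((-δ * x : ℝ) : ℂ) * Complex.I)) t =
      Real.sinc (Real.pi * (t + δ)) := by
  have hpi : (Real.pi : ℂ) ≠ 0 := by exact_mod_cast Real.pi_ne_zero
  rw [fourierCoeffOn_eq_integral]
  have e : ∀ x : ℝ, (fourier (-t) (x : AddCircle (Real.pi - -Real.pi)) : ℂ) •
      Complex.exp (((-δ * x : ℝ) : ℂ) * Complex.I) =
      Complex.exp (((-(t + δ) * x : ℝ) : ℂ) * Complex.I) := by
    intro x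
    rw [fourier_coe_apply, smul_eq_mul, ← Complex.exp_add]
    congr 1
    push_cast
    field_simp
    ring
  simp_rw [e]
  set u : ℝ := t + δ with hu
  have key : ∫ x in -Real.pi..Real.pi, Complex.exp (((-u * x : ℝ) : ℂ) * Complex.I) =
      2 * Real.pi * Real.sinc (Real.pi * u) := by
    by_cases h0 : u = 0
    · simp [h0]; ring
    · have h := intervalIntegral.smul_integral_comp_mul_left
        (fun y : ℝ => Complex.exp ((y : ℂ) * Complex.I)) (-u) (a := -Real.pi) (b := Real.pi)
      rw [show -u * -Real.pi = -(-u * Real.pi) by ring, integral_exp_mul_I_eq_sinc,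
        show -u * Real.pi = -(Real.pi * u) by ring, Real.sinc_neg] at h
      have hu0 : (-u : ℂ) ≠ 0 := by simpa using h0
      apply mul_left_cancel₀ hu0
      have h' : (-u : ℂ) * ∫ x in -Real.pi..Real.pi,
          Complex.exp (((-u * x : ℝ) : ℂ) * Complex.I) =
          2 * ((-(Real.pi * u) : ℝ) : ℂ) * (Real.sinc (Real.pi * u) : ℂ) := by
        rw [← h, Complex.real_smul]; push_cast; rfl
      rw [h']; push_cast; ring
  rw [key, Complex.real_smul]
  push_cast
  field_simp
  ring

/-- Parseval's identity for the Fourier coefficients of `x ↦ exp (-i δ x)`. -/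
theorem hasSum_sinc_sq (δ : ℝ) :
    HasSum (fun t : ℤ => Real.sinc (Real.pi * (t + δ)) ^ 2) 1 := by
  have hcont : Continuous fun x : ℝ => Complex.exp (((-δ * x : ℝ) : ℂ) * Complex.I) := by
    fun_prop
  have hL2 : MeasureTheory.MemLp (fun x : ℝ => Complex.exp (((-δ * x : ℝ) : ℂ) * Complex.I)) 2
      (MeasureTheory.volume.restrict (Set.Ioc (-Real.pi) Real.pi)) :=
    MeasureTheory.MemLp.of_bound hcont.aestronglyMeasurable 1
      (Filter.Eventually.of_forall fun x => (Complex.norm_exp_ofReal_mul_I _).le)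
  have h := hasSum_sq_fourierCoeffOn (neg_lt_self Real.pi_pos) hL2
  simp only [fourierCoeffOn_exp_eq_sinc, Complex.norm_exp_ofReal_mul_I, Complex.norm_real,
    Real.norm_eq_abs, sq_abs] at h
  convert h using 1
  simp

theorem sum_Icc_neg_succ (f : ℤ → ℝ) (n : ℕ) :
    ∑ t ∈ Finset.Icc (-((n + 1 : ℕ) : ℤ)) ((n + 1 : ℕ) : ℤ), f t =
      ∑ t ∈ Finset.Icc (-(n : ℤ)) n, f t + (f ((n + 1 : ℕ) : ℤ) + f (-((n + 1 : ℕ) : ℤ))) := by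
  have : Finset.Icc (-((n + 1 : ℕ) : ℤ)) ((n + 1 : ℕ) : ℤ) =
      insert ((n + 1 : ℕ) : ℤ) (insert (-((n + 1 : ℕ) : ℤ)) (Finset.Icc (-(n : ℤ)) n)) := by
    ext t; simp only [Finset.mem_insert, Finset.mem_Icc]; omega
  rw [this, Finset.sum_insert, Finset.sum_insert]
  · ring
  · simp only [Finset.mem_Icc]; omega
  · simp only [Finset.mem_insert, Finset.mem_Icc]; omega

/-- From `|sin| ≤ 1` and `(n + 1/2)² ≥ n (n + 1)`; the bound is written as a difference so that it
telescopes. -/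
theorem sinc_sq_le {n : ℕ} (hn : 1 ≤ n) {u : ℝ} (hu : (n : ℝ) + 1 / 2 ≤ |u|) :
    Real.sinc (Real.pi * u) ^ 2 ≤ 1 / Real.pi ^ 2 * (1 / n - 1 / ((n : ℝ) + 1)) := by
  have hn' : (1 : ℝ) ≤ n := by exact_mod_cast hn
  have hpos : 0 < |u| := by linarith
  have hu0 : u ≠ 0 := abs_pos.1 hpos
  have h1 : Real.sinc (Real.pi * u) ^ 2 ≤ (|Real.pi * u|⁻¹) ^ 2 := by
    rw [← sq_abs (Real.sinc _)]
    gcongr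
    rw [abs_le]
    refine ⟨?_, Real.sinc_le_inv_abs (mul_ne_zero Real.pi_ne_zero hu0)⟩
    rw [Real.sinc_of_ne_zero (mul_ne_zero Real.pi_ne_zero hu0), ← neg_neg (Real.sin _ / _),
      neg_le_neg_iff, ← neg_div]
    refine (le_abs_self _).trans ?_
    rw [abs_div, abs_neg, ← one_div]
    gcongr
    exact Real.abs_sin_le_one _
  refine h1.trans ?_
  rw [inv_pow, sq_abs, mul_pow, mul_inv, ← one_div (Real.pi ^ 2)]
  gcongr
  have e : 1 / (n : ℝ) - 1 / ((n : ℝ) + 1) = (n * (n + 1) : ℝ)⁻¹ := by field_simp; ring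
  rw [e]
  gcongr
  rw [← sq_abs u]
  nlinarith

theorem sum_sinc_sq_ge {δ : ℝ} (hδ : |δ| ≤ 1 / 2) {B : ℕ} (hB : 1 ≤ B) :
    1 - 1 / Real.pi ^ 2 * (2 / B) ≤
      ∑ t ∈ Finset.Icc (-(B : ℤ)) B, Real.sinc (Real.pi * (t + δ)) ^ 2 := by
  set f : ℤ → ℝ := fun t => Real.sinc (Real.pi * (t + δ)) ^ 2 with hf
  have hδ' := abs_le.1 hδ
  -- As `|δ| ≤ 1/2`, the terms `t = ±(L + 1)` have `|t + δ| ≥ L + 1/2`, so each pair costs twice one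
  -- telescoping difference.
  have step : ∀ L : ℕ, B ≤ L → ∑ t ∈ Finset.Icc (-(L : ℤ)) L, f t ≤
      ∑ t ∈ Finset.Icc (-(B : ℤ)) B, f t + 1 / Real.pi ^ 2 * (2 / B - 2 / L) := by
    intro L hL
    induction L, hL using Nat.le_induction with
    | base => simp
    | succ L hL ih =>
      rw [sum_Icc_neg_succ]
      have h1 : f ((L + 1 : ℕ) : ℤ) ≤ 1 / Real.pi ^ 2 * (1 / L - 1 / ((L : ℝ) + 1)) := by
        apply sinc_sq_le (by omega)
        push_cast
        exact le_trans (by linarith [hδ'.1]) (le_abs_self _)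
      have h2 : f (-((L + 1 : ℕ) : ℤ)) ≤ 1 / Real.pi ^ 2 * (1 / L - 1 / ((L : ℝ) + 1)) := by
        apply sinc_sq_le (by omega)
        push_cast
        exact le_trans (by linarith [hδ'.2]) (neg_le_abs _)
      have e : 1 / Real.pi ^ 2 * (2 / (B : ℝ) - 2 / ((L + 1 : ℕ) : ℝ)) =
          1 / Real.pi ^ 2 * (2 / (B : ℝ) - 2 / L) +
            2 * (1 / Real.pi ^ 2 * (1 / L - 1 / ((L : ℝ) + 1))) := by push_cast; ring
      rw [e]
      linarith
  have htend : Filter.Tendsto (fun L : ℕ => Finset.Icc (-(L : ℤ)) L) Filter.atTop Filter.atTop := by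
    refine Filter.tendsto_atTop_finset_of_monotone (fun a b h => ?_) fun t => ⟨t.natAbs, ?_⟩
    · exact Finset.Icc_subset_Icc (by omega) (by omega)
    · rw [Finset.mem_Icc]; omega
  have hlim := (hasSum_sinc_sq δ).comp htend
  have : (1 : ℝ) ≤ ∑ t ∈ Finset.Icc (-(B : ℤ)) B, f t + 1 / Real.pi ^ 2 * (2 / B) := by
    refine le_of_tendsto hlim (Filter.eventually_atTop.2 ⟨B, fun L hL => (step L hL).trans ?_⟩)
    gcongr
    have : (0 : ℝ) ≤ 2 / L := by positivity
    linarith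
  linarith

/-! ### The distribution of the measured frequency -/

/-- A geometric sum of `M ≈ N / r` roots of unity near an integer multiple of the period. -/
theorem sinc_sq_le_norm_geom_sum_sq {N r M : ℕ} (hr : 0 < r) (hrN : r ≤ N)
    (hM : |(M : ℝ) * r - N| ≤ r) (u : ℝ) :
    Real.sinc (Real.pi * u) ^ 2 / r ^ 2 - 3 / (r * N) ≤
      ‖∑ k ∈ Finset.range M, Complex.exp (Complex.I * (2 * Real.pi * r * u / N : ℝ)) ^ k‖ ^ 2 /
        N ^ 2 := by
  have hr' : (0 : ℝ) < r := by exact_mod_cast hr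
  have hrN' : (r : ℝ) ≤ N := by exact_mod_cast hrN
  have hN' : (0 : ℝ) < N := by linarith
  have hM' := abs_le.1 hM
  by_cases hu : u = 0
  · subst hu
    simp only [mul_zero, zero_div, Complex.ofReal_zero, Complex.exp_zero, one_pow,
      Finset.sum_const, Finset.card_range, Real.sinc_zero, nsmul_eq_mul, mul_one,
      Complex.norm_natCast]
    rw [div_sub_div _ _ (by positivity) (by positivity), div_le_div_iff₀ (by positivity)
      (by positivity)]
    have h1 : (N : ℝ) ^ 2 - 3 * (r * N) ≤ (M * r) ^ 2 := by nlinarith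
    calc _ = (N ^ 2 - 3 * (r * N) : ℝ) * (N * r) := by ring
      _ ≤ (M * r) ^ 2 * (N * r) := by gcongr
      _ = _ := by ring
  set θ : ℝ := 2 * Real.pi * r * u / N with hθ
  set S := ∑ k ∈ Finset.range M, Complex.exp (Complex.I * θ) ^ k
  set b : ℝ := Real.pi * u with hb
  have hb0 : b ≠ 0 := mul_ne_zero Real.pi_ne_zero hu
  have hθb : θ = 2 * b * r / N := by rw [hθ, hb]; ring
  have hgeom : S * (Complex.exp (Complex.I * θ) - 1) =
      Complex.exp (Complex.I * ((M * θ : ℝ) : ℂ)) - 1 := by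
    rw [geom_sum_mul, ← Complex.exp_nat_mul]
    congr 2
    push_cast
    ring
  -- Norms in the geometric sum formula: the numerator is exactly `2 |sin (M θ / 2)|`, and the
  -- denominator is at most `|θ|`.
  have h1 : (2 * Real.sin (M * θ / 2)) ^ 2 ≤ ‖S‖ ^ 2 * θ ^ 2 := by
    have := congrArg norm hgeom
    rw [norm_mul, Complex.norm_exp_I_mul_ofReal_sub_one (M * θ), Real.norm_eq_abs] at this
    rw [← sq_abs (2 * _), ← this, mul_pow, ← sq_abs θ]
    gcongr
    exact Real.norm_exp_I_mul_ofReal_sub_one_le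
  set a : ℝ := M * θ / 2 with ha
  set η : ℝ := (M * r - N) / N with hη
  have hη1 : |η| ≤ r / N := by rw [hη, abs_div, abs_of_pos hN']; gcongr
  have hη2 : |2 + η| ≤ 3 := by
    have : (r : ℝ) / N ≤ 1 := (div_le_one hN').2 hrN'
    have := abs_le.1 (hη1.trans this)
    rw [abs_le]; constructor <;> linarith
  -- Replacing `M r` by `N` turns `sin a` into `sin b`. The difference of squares is `sin (b - a)
  -- sin (b + a)`, at most `b² |η| |2 + η|` with `|η| ≤ r / N ≤ 1`; this is the origin of the
  -- constant 3.
  have h2 : Real.sin b ^ 2 - Real.sin a ^ 2 ≤ b ^ 2 * (3 * (r / N)) := by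
    have e : Real.sin b ^ 2 - Real.sin a ^ 2 = Real.sin (b - a) * Real.sin (b + a) := by
      rw [Real.sin_sub, Real.sin_add]
      linear_combination (Real.sin b ^ 2) * (Real.sin_sq_add_cos_sq a).symm -
        (Real.sin a ^ 2) * (Real.sin_sq_add_cos_sq b).symm
    have hsub : b - a = -(b * η) := by rw [ha, hθb, hη]; field_simp; ring
    have hadd : b + a = b * (2 + η) := by rw [ha, hθb, hη]; field_simp; ring
    calc _ ≤ |Real.sin (b - a)| * |Real.sin (b + a)| := by
          rw [e, ← abs_mul]; exact le_abs_self _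
      _ ≤ |b - a| * |b + a| := 
          mul_le_mul Real.abs_sin_le_abs Real.abs_sin_le_abs (abs_nonneg _) (abs_nonneg _)
      _ = |b| ^ 2 * (|2 + η| * |η|) := by rw [hsub, hadd, abs_neg, abs_mul b η, abs_mul b (2 + η)]; ring
      _ ≤ |b| ^ 2 * (3 * (r / N)) := by gcongr
      _ = _ := by rw [sq_abs]
  rw [Real.sinc_of_ne_zero hb0]
  have h3 : Real.sin b ^ 2 - b ^ 2 * (3 * (r / N)) ≤ ‖S‖ ^ 2 * (b * r / N) ^ 2 := by
    have : θ ^ 2 = 4 * (b * r / N) ^ 2 := by rw [hθb]; ring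
    rw [this] at h1
    linarith
  have hbr : 0 < (b * r) ^ 2 := by positivity
  calc _ = (Real.sin b ^ 2 - b ^ 2 * (3 * (r / N))) / (b * r) ^ 2 := by field_simp
    _ ≤ ‖S‖ ^ 2 * (b * r / N) ^ 2 / (b * r) ^ 2 := by gcongr
    _ = _ := by field_simp

section State

variable {G : Type*} [Group G] [Fintype G] [DecidableEq G]

theorem state_apply (g : G) (n : ℕ) (j : Fin (2 ^ n)) (h : G) :
    state g n (j, h) = ∑ a ∈ (Finset.range (2 ^ n)).filter (fun a => g ^ a = h),
      1 / (2 : ℂ) ^ n *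
        Complex.exp (2 * Real.pi * Complex.I / (2 : ℂ) ^ n * (a : ℂ) * ((j : ℕ) : ℂ)) := by
  rw [Finset.sum_filter, ← Fin.sum_univ_eq_sum_range (fun a => if g ^ a = h then
    1 / (2 : ℂ) ^ n *
      Complex.exp (2 * Real.pi * Complex.I / (2 : ℂ) ^ n * (a : ℂ) * ((j : ℕ) : ℂ)) else 0)]
  simp only [state, WithLp.ofLp_sum, Finset.sum_apply, WithLp.ofLp_smul, Pi.smul_apply,
    smul_eq_mul]
  refine Finset.sum_congr rfl fun a _ => ?_
  rw [Finset.sum_eq_single j]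
  · simp [eq_comm]
  · intro j' _ hj'
    simp [hj'.symm]
  · simp

theorem filter_modEq_range {N r b : ℕ} (hb : b < r) (hrN : r ≤ N) :
    (Finset.range N).filter (fun a => a ≡ b [MOD r]) =
      (Finset.range ((N - 1 - b) / r + 1)).image (fun k => b + r * k) := by
  have hr : 0 < r := by omega
  ext a
  simp only [Finset.mem_filter, Finset.mem_range, Finset.mem_image, Nat.lt_succ_iff,
    Nat.le_div_iff_mul_le hr]
  constructor
  · rintro ⟨haN, hab⟩
    rw [Nat.ModEq, Nat.mod_eq_of_lt hb] at hab
    refine ⟨a / r, ?_, by rw [← hab]; exact Nat.mod_add_div a r⟩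
    have := Nat.mod_add_div a r
    rw [mul_comm]; omega
  · rintro ⟨k, hk, rfl⟩
    refine ⟨by rw [mul_comm]; omega, ?_⟩
    simp [Nat.ModEq]

/-- The exponents contributing to `g ^ b` are `b + r k`, with `r` the order of `g`. The phase from
`b` has modulus one, and moving `j` by `z 2 ^ n / r` changes the `k`-th phase by a multiple of `2π`,
so any `z` may be used. -/
theorem norm_state_apply_pow (g : G) (n : ℕ) (hn : orderOf g ≤ 2 ^ n) (j : Fin (2 ^ n)) (z : ℤ)
    {b : ℕ} (hb : b < orderOf g) :
    ‖state g n (j, g ^ b)‖ = ‖∑ k ∈ Finset.range ((2 ^ n - 1 - b) / orderOf g + 1),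
      Complex.exp (Complex.I * (2 * Real.pi * orderOf g *
        ((j : ℕ) - z * 2 ^ n / orderOf g) / (2 ^ n : ℕ) : ℝ)) ^ k‖ / 2 ^ n := by
  have hr : (orderOf g : ℂ) ≠ 0 := by exact_mod_cast (orderOf_pos g).ne'
  rw [state_apply]
  simp only [pow_eq_pow_iff_modEq]
  rw [filter_modEq_range hb hn, Finset.sum_image (fun a _ b _ h => by
    have := Nat.eq_of_mul_eq_mul_left (orderOf_pos g) (Nat.add_left_cancel h); exact this)]
  have e : ∀ k : ℕ, 1 / (2 : ℂ) ^ n * Complex.exp (2 * Real.pi * Complex.I / (2 : ℂ) ^ n *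
      ((b + orderOf g * k : ℕ) : ℂ) * ((j : ℕ) : ℂ)) =
      (1 / (2 : ℂ) ^ n *
        Complex.exp (((2 * Real.pi / 2 ^ n * b * (j : ℕ) : ℝ) : ℂ) * Complex.I)) *
      Complex.exp (Complex.I * (2 * Real.pi * orderOf g *
        ((j : ℕ) - z * 2 ^ n / orderOf g) / (2 ^ n : ℕ) : ℝ)) ^ k := by
    intro k
    rw [← Complex.exp_nat_mul, mul_assoc (1 / (2 : ℂ) ^ n) (Complex.exp _), ← Complex.exp_add]
    congr 1
    rw [Complex.exp_eq_exp_iff_exists_int]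
    refine ⟨z * k, ?_⟩
    push_cast
    field_simp
    ring
  simp only [e]
  rw [← Finset.mul_sum, norm_mul, norm_mul, Complex.norm_exp_ofReal_mul_I]
  simp
  ring

theorem freqProb_ge {g : G} (hg : ∀ y : G, y ∈ Subgroup.zpowers g) {n : ℕ}
    (hn : orderOf g ≤ 2 ^ n) (j : Fin (2 ^ n)) (z : ℤ) :
    Real.sinc (Real.pi * ((j : ℕ) - z * 2 ^ n / orderOf g)) ^ 2 / orderOf g - 3 / 2 ^ n ≤
      freqProb g n j := by
  have hr : (orderOf g : ℝ) ≠ 0 := by exact_mod_cast (orderOf_pos g).ne'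
  rw [freqProb, ← IsCyclic.image_range_orderOf hg, Finset.sum_image (fun a ha b hb h =>
    pow_injOn_Iio_orderOf (by simpa using ha) (by simpa using hb) h)]
  set u : ℝ := (j : ℕ) - z * 2 ^ n / orderOf g with hu
  calc Real.sinc (Real.pi * u) ^ 2 / orderOf g - 3 / 2 ^ n
      = ∑ b ∈ Finset.range (orderOf g), (Real.sinc (Real.pi * u) ^ 2 / (orderOf g : ℝ) ^ 2 -
          3 / (orderOf g * (2 ^ n : ℕ))) := by
        rw [Finset.sum_const, Finset.card_range, nsmul_eq_mul]
        push_cast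
        field_simp
    _ ≤ _ := by
        refine Finset.sum_le_sum fun b hb => ?_
        have hb' := Finset.mem_range.1 hb
        rw [norm_state_apply_pow g n hn j z hb', ← hu, div_pow]
        have hM : |(((2 ^ n - 1 - b) / orderOf g + 1 : ℕ) : ℝ) * orderOf g - (2 ^ n : ℕ)| ≤
            orderOf g := by
          have h1 := Nat.div_add_mod (2 ^ n - 1 - b) (orderOf g)
          have h2 := Nat.mod_lt (2 ^ n - 1 - b) (orderOf_pos g)
          have h3 : ((2 ^ n - 1 - b) / orderOf g + 1) * orderOf g ≤ 2 ^ n + orderOf g := by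
            rw [add_mul, mul_comm]; omega
          have h4 : 2 ^ n ≤ ((2 ^ n - 1 - b) / orderOf g + 1) * orderOf g + orderOf g := by
            rw [add_mul, mul_comm]; omega
          rw [abs_le]
          constructor
          · have : ((2 ^ n : ℕ) : ℝ) ≤
              (((2 ^ n - 1 - b) / orderOf g + 1 : ℕ) : ℝ) * orderOf g + orderOf g := by
              exact_mod_cast h4
            linarith
          · have : (((2 ^ n - 1 - b) / orderOf g + 1 : ℕ) : ℝ) * orderOf g ≤
              ((2 ^ n : ℕ) : ℝ) + orderOf g := by exact_mod_cast h3
            linarith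
        have := sinc_sq_le_norm_geom_sum_sq (orderOf_pos g) hn hM u
        simpa using this

theorem freqProb_nonneg (g : G) (n : ℕ) (j : Fin (2 ^ n)) : 0 ≤ freqProb g n j :=
  Finset.sum_nonneg fun _ _ => sq_nonneg _

end State

/-! ### Peaks, their windows and their candidates -/

/-- The integer `k` accounts for reduction of the frequency modulo `2 ^ n`: it replaces `z` by `z -
k r`, which leaves the reduced denominator of `z / r` unchanged. -/
theorem solve_eq {n : ℕ} {solve : ℤ → ℕ} (hs : solve = cfSolver n ∨ IsLatticeSolver n solve)
    {r z : ℕ} {k j : ℤ} (hr : 0 < r) (hrn : r ^ 2 < 2 ^ n)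
    (h : 2 * |j * r - (z - k * r) * 2 ^ n| ≤ (r : ℤ)) : solve j = r / Nat.gcd z r := by
  obtain ⟨d, a, b, hd, hcop, rfl, rfl⟩ := Nat.exists_coprime' (Nat.gcd_pos_of_pos_right z hr)
  have hb : 0 < b := Nat.pos_of_mul_pos_right hr
  rw [Nat.gcd_mul_right, hcop.gcd_eq_one, one_mul, Nat.mul_div_cancel _ hd]
  have hc : Nat.Coprime ((a : ℤ) - k * b).natAbs (b : ℤ).natAbs := by
    rw [← Int.isCoprime_iff_nat_coprime, sub_eq_add_neg, ← neg_mul]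
    exact (Nat.isCoprime_iff_coprime.2 hcop).add_mul_right_left (-k)
  set q : ℚ := (((a : ℤ) - k * b : ℤ) : ℚ) / ((b : ℤ) : ℚ) with hq
  have hnum : q.num = a - k * b := Rat.num_div_eq_of_coprime (by exact_mod_cast hb) hc
  have hden : q.den = b := by
    apply Nat.cast_injective (R := ℤ)
    exact Rat.den_div_eq_of_coprime (by exact_mod_cast hb) hc
  have h1 : q.den ^ 2 < 2 ^ n := by
    rw [hden]
    exact lt_of_le_of_lt (Nat.pow_le_pow_left (Nat.le_mul_of_pos_right b hd) 2) hrn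
  have h2 : 2 * |j * q.den - q.num * 2 ^ n| ≤ (q.den : ℤ) := by
    rw [hden, hnum]
    have hd' : (0 : ℤ) < d := by exact_mod_cast hd
    have e : j * ((b * d : ℕ) : ℤ) - (((a * d : ℕ) : ℤ) - k * ((b * d : ℕ) : ℤ)) * 2 ^ n =
        (j * b - (a - k * b) * 2 ^ n) * d := by push_cast; ring
    rw [e, abs_mul, abs_of_pos hd'] at h
    push_cast at h
    refine le_of_mul_le_mul_right ?_ hd'
    linarith
  rw [← hden]
  rcases hs with rfl | hs
  · exact cfSolver_eq_den h1 h2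
  · exact latticeSolver_eq_den hs h1 h2

/-- The frequency, reduced modulo `2 ^ n`, at offset `t` from the peak with index `z`. -/
noncomputable def peakFreq (n r : ℕ) (p : ℕ × ℤ) : Fin (2 ^ n) :=
  ⟨((round ((p.1 : ℝ) * 2 ^ n / r) + p.2) % 2 ^ n).toNat, by
    have h1 := Int.emod_nonneg (round ((p.1 : ℝ) * 2 ^ n / r) + p.2)
      (b := 2 ^ n) (by positivity)
    have h2 := Int.emod_lt_of_pos (round ((p.1 : ℝ) * 2 ^ n / r) + p.2)
      (b := 2 ^ n) (by positivity)
    zify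
    rwa [Int.toNat_of_nonneg h1]⟩

theorem exists_peakFreq_eq (n r : ℕ) (p : ℕ × ℤ) : ∃ k : ℤ,
    ((peakFreq n r p : ℕ) : ℤ) = round ((p.1 : ℝ) * 2 ^ n / r) + p.2 - k * 2 ^ n := by
  refine ⟨(round ((p.1 : ℝ) * 2 ^ n / r) + p.2) / 2 ^ n, ?_⟩
  have h1 := Int.emod_nonneg (round ((p.1 : ℝ) * 2 ^ n / r) + p.2)
    (b := 2 ^ n) (by positivity)
  rw [peakFreq, Int.toNat_of_nonneg h1, Int.emod_def]
  ring

theorem peakFreq_injOn {n r B : ℕ} (hr : 0 < r) (hB : 2 * (B : ℝ) + 1 < 2 ^ n / r) (Z : Finset ℕ)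
    (hZ : Z ⊆ Finset.range r) :
    Set.InjOn (peakFreq n r) (Z ×ˢ Finset.Icc (-(B : ℤ)) B : Finset (ℕ × ℤ)) := by
  rintro ⟨z, t⟩ h ⟨z', t'⟩ h' heq
  simp only [Finset.coe_product, Set.mem_prod, Finset.mem_coe, Finset.mem_Icc] at h h'
  have hz := Finset.mem_range.1 (hZ h.1)
  have hz' := Finset.mem_range.1 (hZ h'.1)
  obtain ⟨k, hk⟩ := exists_peakFreq_eq n r (z, t)
  obtain ⟨k', hk'⟩ := exists_peakFreq_eq n r (z', t')
  rw [← heq, hk] at hk'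
  simp only at hk'
  have hr' : (0 : ℝ) < r := by exact_mod_cast hr
  have d := abs_le.1 (abs_sub_round ((z : ℝ) * 2 ^ n / r))
  have d' := abs_le.1 (abs_sub_round ((z' : ℝ) * 2 ^ n / r))
  have hkR : (round ((z : ℝ) * 2 ^ n / r) : ℝ) + t - k * 2 ^ n =
      round ((z' : ℝ) * 2 ^ n / r) + t' - k' * 2 ^ n := by exact_mod_cast hk'
  have ht : (-(B : ℝ) ≤ t ∧ (t : ℝ) ≤ B) ∧ -(B : ℝ) ≤ t' ∧ (t' : ℝ) ≤ B := by
    exact_mod_cast And.intro h.2 h'.2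
  obtain ⟨⟨ht1, ht2⟩, ht3, ht4⟩ := ht
  -- `|w| 2 ^ n / r` is at most `2B` from the offsets plus 1 from the two roundings, hence less than
  -- `2 ^ n / r`. So `w = 0`, that is `z ≡ z'` modulo `r`.
  set w : ℤ := z - z' - (k - k') * r with hw
  have hwR : (w : ℝ) * (2 ^ n / r) =
      (z : ℝ) * 2 ^ n / r - (z' : ℝ) * 2 ^ n / r - (k - k') * 2 ^ n := by
    rw [hw]; push_cast; field_simp
  have hN : (0 : ℝ) < 2 ^ n / r := by positivity
  have hw1 : |(w : ℝ)| < 1 := by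
    have : |(w : ℝ) * (2 ^ n / r)| < 2 ^ n / r := by
      rw [hwR, abs_lt]; constructor <;> linarith
    rw [abs_mul, abs_of_pos hN] at this
    by_contra hc
    nlinarith
  have hw0 : w = 0 := Int.abs_lt_one_iff.1 (by exact_mod_cast hw1)
  have hzz : z = z' := by
    have e : (z : ℤ) = z' + (k - k') * r := by linarith
    have : (z : ℤ) % r = z' % r := by rw [e, Int.add_mul_emod_self_right]
    rw [Int.emod_eq_of_lt (by omega) (by omega), Int.emod_eq_of_lt (by omega) (by omega)] at this
    exact_mod_cast this
  subst hzz
  have hkk : k = k' := by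
    have : (k - k') * (r : ℤ) = 0 := by linarith
    rcases mul_eq_zero.1 this with h0 | h0 <;> omega
  subst hkk
  have : t = t' := by linarith
  rw [this]

theorem sum_freqProb_peak_ge {G : Type*} [Group G] [Fintype G] [DecidableEq G] {g : G}
    (hg : ∀ y : G, y ∈ Subgroup.zpowers g) {n : ℕ} (hn : orderOf g ≤ 2 ^ n) {B : ℕ} (hB : 1 ≤ B)
    (z : ℕ) :
    (1 - 1 / Real.pi ^ 2 * (2 / B)) / orderOf g - (2 * B + 1) * (3 / 2 ^ n) ≤
      ∑ t ∈ Finset.Icc (-(B : ℤ)) B, freqProb g n (peakFreq n (orderOf g) (z, t)) := by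
  have hr : (0 : ℝ) < orderOf g := by exact_mod_cast orderOf_pos g
  set y : ℝ := (z : ℝ) * 2 ^ n / orderOf g with hy
  have hδ : |(round y : ℝ) - y| ≤ 1 / 2 := by rw [abs_sub_comm]; exact abs_sub_round y
  have hcard : ((Finset.Icc (-(B : ℤ)) B).card : ℝ) = 2 * B + 1 := by
    have : (Finset.Icc (-(B : ℤ)) B).card = 2 * B + 1 := by rw [Int.card_Icc]; omega
    rw [this]; push_cast; ring
  calc _ ≤ (∑ t ∈ Finset.Icc (-(B : ℤ)) B, Real.sinc (Real.pi * (t + (round y - y))) ^ 2) /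
        orderOf g - (2 * B + 1) * (3 / 2 ^ n) := by
        gcongr; exact sum_sinc_sq_ge hδ hB
    _ = ∑ t ∈ Finset.Icc (-(B : ℤ)) B,
        (Real.sinc (Real.pi * (t + (round y - y))) ^ 2 / orderOf g - 3 / 2 ^ n) := by
        rw [Finset.sum_sub_distrib, Finset.sum_div, Finset.sum_const, nsmul_eq_mul, hcard]
    _ ≤ _ := by
        refine Finset.sum_le_sum fun t _ => ?_
        obtain ⟨k, hk⟩ := exists_peakFreq_eq n (orderOf g) (z, t)
        -- The peak index `z - k r` cancels the reduction modulo `2 ^ n`, so the distance to the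
        -- peak is `t` plus the rounding error.
        have h := freqProb_ge hg hn (peakFreq n (orderOf g) (z, t)) (z - k * orderOf g)
        have e : ((peakFreq n (orderOf g) (z, t) : ℕ) : ℝ) -
            ((z - k * orderOf g : ℤ) : ℝ) * 2 ^ n / orderOf g = t + (round y - y) := by
          have hk' : ((peakFreq n (orderOf g) (z, t) : ℕ) : ℝ) = round y + t - k * 2 ^ n := by
            have := congrArg (Int.cast : ℤ → ℝ) hk
            push_cast at this
            exact this
          rw [hk', hy]
          push_cast
          field_simp
          ring
        rwa [e] at h

theorem div_gcd_mem_candidates {n r B : ℕ} {solve : ℤ → ℕ}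
    (hs : solve = cfSolver n ∨ IsLatticeSolver n solve) (hr : 0 < r) (hrn : r ^ 2 < 2 ^ n)
    (z : ℕ) {t : ℤ} (ht : t ∈ Finset.Icc (-(B : ℤ)) B) :
    r / Nat.gcd z r ∈ candidates solve B ((peakFreq n r (z, t) : ℕ) : ℤ) := by
  obtain ⟨k, hk⟩ := exists_peakFreq_eq n r (z, t)
  rw [Finset.mem_Icc] at ht
  -- Offset `-t` returns to the rounded peak, whose error of at most `1/2` becomes at most `r / 2`
  -- after multiplication by `r`.
  refine Finset.mem_image.2 ⟨-t, Finset.mem_Icc.2 ⟨by omega, by omega⟩, ?_⟩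
  rw [hk]
  apply solve_eq (k := k) hs hr hrn
  have hr' : (0 : ℝ) < r := by exact_mod_cast hr
  have d := abs_sub_round ((z : ℝ) * 2 ^ n / r)
  set R := round ((z : ℝ) * 2 ^ n / r)
  have e : (R + t - k * 2 ^ n + -t) * r - (z - k * r) * 2 ^ n = R * r - z * 2 ^ n := by ring
  simp only [e]
  have : 2 * |(R * r - z * 2 ^ n : ℝ)| ≤ r := by
    have e2 : (R * r - z * 2 ^ n : ℝ) = -((z * 2 ^ n / r - R) * r) := by field_simp; ring
    rw [e2, abs_neg, abs_mul, abs_of_pos hr']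
    nlinarith
  exact_mod_cast this

end OrderFinding

/-! ### Assembling the bound -/

theorem mainTheorem1 {G : Type*} [Group G] [Fintype G] [DecidableEq G]
    (g : G) (hg : ∀ y : G, y ∈ Subgroup.zpowers g)
    (r : ℕ) (hr : Fintype.card G = r) (hr2 : 2 ≤ r)
    (m ℓ : ℕ) (hm : 0 < m) (hℓ : 0 < ℓ) (hmr : r < 2 ^ m) (hmℓ : r ^ 2 < 2 ^ (m + ℓ))
    (c : ℝ) (hc : 1 ≤ c)
    (B : ℕ) (hB : 1 ≤ B) (hBmax : (B : ℝ) < ((2 : ℝ) ^ (m + ℓ) / r - 1) / 2)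
    (solve : ℤ → ℕ)
    (hsolve : solve = OrderFinding.cfSolver (m + ℓ) ∨ OrderFinding.IsLatticeSolver (m + ℓ) solve)
    (prep : Finset ℕ → Finset ℕ)
    (hprep : prep = id ∨ prep = OrderFinding.filterCandidates g (c * m) m)
    (recover : ℕ → Option ℕ)
    (hrecover : recover = OrderFinding.recoverStack g (c * m) m ∨
      recover = OrderFinding.recoverTree g (c * m) m) :
    OrderFinding.successBound r m ℓ B c ≤
      OrderFinding.successProb g (m + ℓ) r B solve prep recover := by
  open OrderFinding in
  have hord : orderOf g = r := by
    rw [← hr, ← Nat.card_eq_fintype_card]; exact orderOf_eq_card_of_forall_mem_zpowers hg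
  subst hord
  clear hr
  set r := orderOf g with hrdef
  set n := m + ℓ with hn
  have hr0 : 0 < r := by omega
  have hr' : (0 : ℝ) < r := by exact_mod_cast hr0
  -- `2 ≤ r < 2 ^ m` excludes `m = 1`; hence `c * m ≥ 2`, so the list of primes is non-empty and the
  -- logarithm is at least 1.
  have hm2 : 2 ≤ m := by
    by_contra hlt
    obtain rfl : m = 1 := by omega
    omega
  have hm2' : (2 : ℝ) ≤ m := by exact_mod_cast hm2
  have hx : 2 ≤ c * m := by nlinarith
  have hlog : 1 ≤ Real.logb 2 (c * m) := by
    rw [Real.le_logb_iff_rpow_le (by norm_num) (by linarith)]; simpa using hx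
  have hrn : r ≤ 2 ^ n := by nlinarith
  set Z := (Finset.range r).filter
    fun z => Nat.gcd z r ∣ primePowerProd (c * m) (primesUpTo (c * m)) with hZ
  set T := Finset.Icc (-(B : ℤ)) B with hT
  have hinj := peakFreq_injOn (n := n) (B := B) hr0 (by linarith) Z (Finset.filter_subset _ _)
  have hsucc : ∑ z ∈ Z, ∑ t ∈ T, freqProb g n (peakFreq n r (z, t)) ≤
      successProb g n r B solve prep recover := by
    rw [← Finset.sum_product', ← Finset.sum_image (f := freqProb g n) hinj]
    refine Finset.sum_le_sum_of_subset_of_nonneg (fun j hj => ?_)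
      fun j _ _ => freqProb_nonneg g n j
    obtain ⟨⟨z, t⟩, hp, rfl⟩ := Finset.mem_image.1 hj
    obtain ⟨hz, ht⟩ := Finset.mem_product.1 hp
    refine Finset.mem_filter.2 ⟨Finset.mem_univ _, ?_⟩
    exact minRecovered_eq_orderOf hx hmr hrecover hprep (Nat.gcd_dvd_right z r)
      (Finset.mem_filter.1 hz).2 (div_gcd_mem_candidates hsolve hr0 hmℓ z ht)
  set A' : ℝ := 1 - 1 / Real.pi ^ 2 * (2 / B) - 3 * r * (2 * B + 1) / 2 ^ n with hA'
  have hlow : (Z.card : ℝ) / r * A' ≤ successProb g n r B solve prep recover := by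
    refine le_trans ?_ hsucc
    calc _ = ∑ _z ∈ Z, ((1 - 1 / Real.pi ^ 2 * (2 / B)) / r - (2 * B + 1) * (3 / 2 ^ n)) := by
          rw [Finset.sum_const, nsmul_eq_mul, hA']; field_simp
      _ ≤ _ := Finset.sum_le_sum fun z _ => sum_freqProb_peak_ge hg hrn hB z
  have hZcard : 1 - 1 / (c * Real.logb 2 (c * m)) ≤ (Z.card : ℝ) / r := by
    have h1 := card_filter_not_dvd_le hx hr0 hmr
    have h2 := Finset.card_filter_add_card_filter_not (s := Finset.range r)
      (fun z => Nat.gcd z r ∣ primePowerProd (c * m) (primesUpTo (c * m)))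
    rw [← hZ, Finset.card_range] at h2
    have h2' : (Z.card : ℝ) + (((Finset.range r).filter
      fun z => ¬ Nat.gcd z r ∣ primePowerProd (c * m) (primesUpTo (c * m))).card : ℝ) = r := by
      exact_mod_cast h2
    set b : ℝ := (((Finset.range r).filter
      fun z => ¬ Nat.gcd z r ∣ primePowerProd (c * m) (primesUpTo (c * m))).card : ℝ)
    have h3 : b * (c * Real.logb 2 (c * m)) ≤ r := by
      have : b * (c * Real.logb 2 (c * m)) * m ≤ r * m := by linarith
      exact le_of_mul_le_mul_right this (by linarith)
    have hcl : 0 < c * Real.logb 2 (c * m) := by positivity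
    have h4 : b / r ≤ 1 / (c * Real.logb 2 (c * m)) := by
      rw [div_le_div_iff₀ hr' hcl]; linarith
    have h5 : (Z.card : ℝ) / r = 1 - b / r := by
      rw [eq_sub_iff_add_eq, ← add_div, h2', div_self hr'.ne']
    linarith
  have hC : 0 ≤ 1 - 1 / (c * Real.logb 2 (c * m)) := by
    rw [sub_nonneg, div_le_one (by positivity)]
    nlinarith
  rw [successBound, ← hn]
  set A : ℝ := 1 - 1 / Real.pi ^ 2 * (2 / (B : ℝ) + 1 / (B : ℝ) ^ 2 + 1 / (3 * (B : ℝ) ^ 3))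
      - Real.pi ^ 2 * r * (2 * (B : ℝ) + 1) / 2 ^ n with hA
  have hAA : A ≤ A' := by
    have hpi : (3 : ℝ) ≤ Real.pi ^ 2 := by nlinarith [Real.pi_gt_three]
    have h1 : 1 / Real.pi ^ 2 * (2 / (B : ℝ)) ≤
        1 / Real.pi ^ 2 * (2 / (B : ℝ) + 1 / (B : ℝ) ^ 2 + 1 / (3 * (B : ℝ) ^ 3)) := by
      gcongr
      have : (0 : ℝ) ≤ 1 / (B : ℝ) ^ 2 + 1 / (3 * (B : ℝ) ^ 3) := by positivity
      linarith
    have h2 : 3 * r * (2 * (B : ℝ) + 1) / 2 ^ n ≤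
        Real.pi ^ 2 * r * (2 * (B : ℝ) + 1) / 2 ^ n := by gcongr
    rw [hA, hA']
    linarith
  -- The factor estimates can be multiplied only when `A ≥ 0`; otherwise the claimed bound is
  -- nonpositive, since its second factor is nonnegative.
  rcases le_total A 0 with hA0 | hA0
  · exact (mul_nonpos_of_nonpos_of_nonneg hA0 hC).trans
      (Finset.sum_nonneg fun j _ => freqProb_nonneg g n j)
  · calc A * (1 - 1 / (c * Real.logb 2 (c * m))) ≤ A' * ((Z.card : ℝ) / r) := by
          gcongr
          linarith
      _ = (Z.card : ℝ) / r * A' := mul_comm _ _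
      _ ≤ _ := hlow
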